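/- Let $d\in\mathbb N$ and let $k\in\mathbb N_0^d$ be a multi-index. For $1\le p\le\infty$ let $\mathcal F^p_k(\mathbb C^d)$ be the (true) polyanalytic Sobolev–Fock space: the space of functions $F:\mathbb C^d\to\mathbb C$ of the form $$F(z)=e^{\pi|z|^2}\,\frac{\partial^k}{\partial z^k}\Big(e^{-\pi|z|^2}G(z)\Big),\qquad G\ \text{entire on }\mathbb C^d,$$ (with $\partial/\partial z_j=\frac12(\partial/\partial x_j-i\,\partial/\partial y_j)$, $z_j=x_j+iy_j$) for which $\|F\|_{\mathcal F^p_k}:=\big\|F(z)e^{-\pi|z|^2/2}\big\|_{L^p(\mathbb C^d,dz)}<\infty$. Write $z\overline w=\sum_j z_j\overline{w_j}$, and let $\kappa(z,w)=z\overline w$ (or $\kappa(z,w)=\overline z w$; the result holds for either choice). Let $\psi$ be a complex function of two variables in $\mathbb C^d$ such that $(z,w)\mapsto\psi(z-w,z-\overline w)$ is measurable, and suppose that $$SF(z)=\int_{\mathbb C^d}F(w)\,e^{\pi\kappa(z,w)}\,\psi(z-w,z-\overline w)\,e^{-\pi|w|^2}\,dw$$ maps $\mathcal F^1_k(\mathbb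 C^d)$ into $\mathcal F^\infty_k(\mathbb C^d)$. If there is $H\in L^1(\mathbb C^d)$ such that $$\big|\psi(z-w,\overline z-w)\big|\le\big|e^{\pi(|z|^2+|w|^2)/2-\pi w\overline z}\big|\cdot H(z-w)\qquad\text{for almost all }z,w\in\mathbb C^d,$$ then $S$ is bounded on $\mathcal F^p_k(\mathbb C^d)$ for every $1\le p\le\infty$: for each such $p$ there is a constant $C$ such that for every $F\in\mathcal F^p_k(\mathbb C^d)$ the integral defining $SF(z)$ converges absolutely for almost every $z$, $SF$ agrees almost everywhere with a function in $\mathcal F^p_k(\mathbb C^d)$, and $\|SF\|_{\mathcal F^p_k}\le C\|F\|_{\mathcal F^p_k}$. -/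

import Mathlib

open MeasureTheory
open scoped ENNReal NNReal

noncomputable section

/-- The squared Euclidean norm `|z|²` of `z ∈ ℂ^d`.  (The type `Fin d → ℂ` carries Lebesgue measure
and the right topology, but its built-in norm is the sup norm, which is not used anywhere.) -/
def sqNorm {d : ℕ} (z : Fin d → ℂ) : ℝ := ∑ j, ‖z j‖ ^ 2

/-- The Wirtinger derivative `∂/∂z_j = (∂/∂x_j - i ∂/∂y_j) / 2`, where `z_j = x_j + i y_j`. -/
def wirtinger {d : ℕ} (j : Fin d) (F : (Fin d → ℂ) → ℂ) (z : Fin d → ℂ) : ℂ :=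
  (fderiv ℝ F z (Pi.single j 1) - Complex.I * fderiv ℝ F z (Pi.single j Complex.I)) / 2

/-- The iterated Wirtinger derivative `∂^k/∂z^k = ∏_j (∂/∂z_j)^{k_j}` for a multi-index `k`. -/
def wirtingerPow {d : ℕ} (k : Fin d → ℕ) (F : (Fin d → ℂ) → ℂ) : (Fin d → ℂ) → ℂ :=
  (List.finRange d).foldr (fun j G => (wirtinger j)^[k j] G) F

/-- `e^{π|z|²} ∂^k/∂z^k (e^{-π|z|²} G(z))`: the operator that turns the Bargmann transform `G` of `f`
into the polyanalytic Bargmann transform of `f` (up to its nonzero normalising constant). -/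
def polyRaise {d : ℕ} (k : Fin d → ℕ) (G : (Fin d → ℂ) → ℂ) (z : Fin d → ℂ) : ℂ :=
  (Real.exp (Real.pi * sqNorm z) : ℂ) *
    wirtingerPow k (fun v => (Real.exp (-(Real.pi * sqNorm v)) : ℂ) * G v) z

/-- The function `F(z) e^{-π|z|²/2}`. -/
def gaussWeighted {d : ℕ} (F : (Fin d → ℂ) → ℂ) (z : Fin d → ℂ) : ℂ :=
  F z * (Real.exp (-(Real.pi * sqNorm z / 2)) : ℂ)

/-- The Sobolev-Fock norm `(∫ |F(z) e^{-π|z|²/2}|^p dz)^{1/p}` (essential supremum if `p = ∞`). -/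
def fockNorm {d : ℕ} (p : ℝ≥0∞) (F : (Fin d → ℂ) → ℂ) : ℝ≥0∞ :=
  eLpNorm (gaussWeighted F) p volume

/-- The (true) polyanalytic Sobolev-Fock space `𝓕^p_k(ℂ^d)`: all true polyanalytic functions of
multi-index `k`, that is `F = e^{π|z|²} ∂^k (e^{-π|z|²} G)` with `G` entire, for which
`F(z) e^{-π|z|²/2}` lies in `L^p(ℂ^d)`.  For `k = 0` these are the entire functions in that class. -/
def polyFock (d : ℕ) (k : Fin d → ℕ) (p : ℝ≥0∞) : Set ((Fin d → ℂ) → ℂ) :=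
  {F | (∃ G : (Fin d → ℂ) → ℂ, Differentiable ℂ G ∧ F = polyRaise k G) ∧
    MemLp (gaussWeighted F) p volume}

/-- The integrand `F(w) e^{π κ(z,w)} ψ(z - w, z - w̄) e^{-π|w|²}`. -/
def kernelIntegrand {d : ℕ} (κ ψ : (Fin d → ℂ) → (Fin d → ℂ) → ℂ)
    (F : (Fin d → ℂ) → ℂ) (z w : Fin d → ℂ) : ℂ :=
  F w * Complex.exp (Real.pi * κ z w) * ψ (z - w) (z - star w) *
    (Real.exp (-(Real.pi * sqNorm w)) : ℂ)

/-- The integral operator `S F(z) = ∫ F(w) e^{π κ(z,w)} ψ(z - w, z - w̄) e^{-π|w|²} dw`. -/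
def kernelOp {d : ℕ} (κ ψ : (Fin d → ℂ) → (Fin d → ℂ) → ℂ)
    (F : (Fin d → ℂ) → ℂ) (z : Fin d → ℂ) : ℂ :=
  ∫ w, kernelIntegrand κ ψ F z w

end

/-! The norm estimate is a convolution estimate. A measure-preserving real-linear change of
variables exchanging imaginary parts turns the growth condition into a bound on `ψ (z - w) (z - star
w)`. Its Gaussian factors cancel those of the kernel exactly, so `|SF(z)| e^{-π|z|²/2}` is at most
the convolution of `|F| e^{-π|·|²/2}` with `|H|`. Young's inequality gives the bound with constant
`‖H‖₁` for every `p`.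

It remains to see that `SF` has the form `polyRaise k G` with `G` entire, which is assumed only for
`F` of index one. A general `F` is a pointwise limit of such functions with a uniform weighted bound
(`exists_approximation`). By dominated convergence their images converge almost everywhere to `SF`,
and the form survives such limits (`exists_polyRaise_eq_of_tendsto`).

Both facts rest on a pair of integral formulas, `exists_polyRaise_eq_integral` and
`exists_integral_polyRaise_eq`, expressing `polyRaise k G` through `G` and conversely, by
integrating Weyl shifts against a compactly supported function. Since `polyRaise k` commutes with
Weyl shifts, it suffices to work at the origin. There `polyRaise k G` is a plain derivative,
computed by a mollifier. For the inverse, pairing `polyRaise k G` with `z^k` times a cutoff and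
integrating by parts leaves a rotation invariant weight, against which the mean value property
returns a multiple of `G 0`; the choice `G = 1` shows that the multiple is nonzero. Weyl shifts only
translate the weighted modulus up to explicit factors, so both formulas respect weighted bounds and
limits. -/

/-! ### Wirtinger derivatives, antiholomorphic factors and the Gaussian. -/

section WirtingerCalculus

variable {d : ℕ}

/-- Real-smooth functions on `ℂ^d`. -/
abbrev IsSmooth (f : (Fin d → ℂ) → ℂ) : Prop := ContDiff ℝ ((⊤ : ℕ∞) : WithTop ℕ∞) f

theorem IsSmooth.differentiableAt {f : (Fin d → ℂ) → ℂ} (hf : IsSmooth f) (z : Fin d → ℂ) :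
    DifferentiableAt ℝ f z :=
  (ContDiff.differentiable hf (by simp)) z

theorem HasFDerivAt.wirtinger_eq {f : (Fin d → ℂ) → ℂ} {f' : (Fin d → ℂ) →L[ℝ] ℂ}
    {z : Fin d → ℂ} (h : HasFDerivAt f f' z) (j : Fin d) :
    wirtinger j f z = (f' (Pi.single j 1) - Complex.I * f' (Pi.single j Complex.I)) / 2 := by
  rw [wirtinger, h.fderiv]

theorem wirtinger_add {f g : (Fin d → ℂ) → ℂ} {z : Fin d → ℂ} (hf : DifferentiableAt ℝ f z)
    (hg : DifferentiableAt ℝ g z) (j : Fin d) :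
    wirtinger j (fun v => f v + g v) z = wirtinger j f z + wirtinger j g z := by
  rw [(hf.hasFDerivAt.fun_add hg.hasFDerivAt).wirtinger_eq, wirtinger, wirtinger]
  simp only [add_apply]
  ring

theorem wirtinger_mul {f g : (Fin d → ℂ) → ℂ} {z : Fin d → ℂ} (hf : DifferentiableAt ℝ f z)
    (hg : DifferentiableAt ℝ g z) (j : Fin d) :
    wirtinger j (fun v => f v * g v) z = wirtinger j f z * g z + f z * wirtinger j g z := by
  rw [(hf.hasFDerivAt.fun_mul hg.hasFDerivAt).wirtinger_eq, wirtinger, wirtinger]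
  simp only [add_apply, smul_apply, smul_eq_mul]
  ring

theorem wirtinger_sum {ι : Type*} (s : Finset ι) {f : ι → (Fin d → ℂ) → ℂ} {z : Fin d → ℂ}
    (hf : ∀ i ∈ s, DifferentiableAt ℝ (f i) z) (j : Fin d) :
    wirtinger j (fun v => ∑ i ∈ s, f i v) z = ∑ i ∈ s, wirtinger j (f i) z := by
  rw [(HasFDerivAt.fun_sum fun i hi => (hf i hi).hasFDerivAt).wirtinger_eq]
  simp only [wirtinger, sum_apply, Finset.mul_sum, ← Finset.sum_sub_distrib,
    Finset.sum_div]

theorem wirtinger_cexp {f : (Fin d → ℂ) → ℂ} {z : Fin d → ℂ} (hf : DifferentiableAt ℝ f z)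
    (j : Fin d) :
    wirtinger j (fun v => Complex.exp (f v)) z = Complex.exp (f z) * wirtinger j f z := by
  rw [hf.hasFDerivAt.cexp.wirtinger_eq, wirtinger]
  simp only [smul_apply, smul_eq_mul]
  ring

theorem wirtinger_const (c : ℂ) (j : Fin d) (z : Fin d → ℂ) :
    wirtinger j (fun _ => c) z = 0 := by
  simp [(hasFDerivAt_const c z).wirtinger_eq]

theorem wirtinger_comp_add (f : (Fin d → ℂ) → ℂ) (a z : Fin d → ℂ) (j : Fin d) :
    wirtinger j (fun v => f (v + a)) z = wirtinger j f (z + a) := by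
  simp only [wirtinger, fderiv_comp_add_right]

theorem wirtinger_coord (i j : Fin d) (z : Fin d → ℂ) :
    wirtinger j (fun v => v i) z = if i = j then 1 else 0 := by
  have h : HasFDerivAt (fun v : Fin d → ℂ => v i)
    (ContinuousLinearMap.proj (R := ℝ) (φ := fun _ : Fin d => ℂ) i) z :=
    (ContinuousLinearMap.proj (R := ℝ) (φ := fun _ : Fin d => ℂ) i).hasFDerivAt
  rw [h.wirtinger_eq]
  by_cases hij : i = j
  · subst hij
    simp [Complex.I_mul_I]
  · simp [hij]

theorem wirtinger_conj_coord (i j : Fin d) (z : Fin d → ℂ) :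
    wirtinger j (fun v => star (v i)) z = 0 := by
  have h : HasFDerivAt (fun v : Fin d → ℂ => star (v i))
    ((Complex.conjCLE : ℂ →L[ℝ] ℂ).comp
      (ContinuousLinearMap.proj (R := ℝ) (φ := fun _ : Fin d => ℂ) i)) z :=
    ((Complex.conjCLE : ℂ →L[ℝ] ℂ).comp
      (ContinuousLinearMap.proj (R := ℝ) (φ := fun _ : Fin d => ℂ) i)).hasFDerivAt
  rw [h.wirtinger_eq]
  by_cases hij : i = j
  · subst hij
    simp [Complex.I_mul_I]
  · simp [Pi.single_eq_of_ne hij]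

theorem isSmooth_coord (i : Fin d) : IsSmooth (fun v : Fin d → ℂ => v i) :=
  contDiff_apply ℝ ℂ i

theorem isSmooth_conj_coord (i : Fin d) : IsSmooth (fun v : Fin d → ℂ => star (v i)) :=
  Complex.conjCLE.contDiff.comp (contDiff_apply ℝ ℂ i)

theorem IsSmooth.cexp {f : (Fin d → ℂ) → ℂ} (hf : IsSmooth f) :
    IsSmooth (fun v => Complex.exp (f v)) := ContDiff.cexp hf

theorem IsSmooth.comp_add {f : (Fin d → ℂ) → ℂ} (hf : IsSmooth f) (a : Fin d → ℂ) :
    IsSmooth (fun v => f (v + a)) :=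
  ContDiff.comp hf (contDiff_id.add contDiff_const)

theorem IsSmooth.wirtinger {f : (Fin d → ℂ) → ℂ} (hf : IsSmooth f) (j : Fin d) :
    IsSmooth (wirtinger j f) := by
  have h : IsSmooth f := hf
  have h1 : ∀ v : Fin d → ℂ, IsSmooth (fun z => fderiv ℝ f z v) := fun v =>
    (ContDiff.fderiv_right h (by simp)).clm_apply contDiff_const
  exact ((h1 _).sub (contDiff_const.mul (h1 _))).div_const _

/-- The iterated Wirtinger derivative along a list of coordinates. -/
noncomputable def wirtingerList (L : List (Fin d)) (f : (Fin d → ℂ) → ℂ) : (Fin d → ℂ) → ℂ :=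
  L.foldr wirtinger f

@[simp] theorem wirtingerList_nil (f : (Fin d → ℂ) → ℂ) : wirtingerList [] f = f := rfl

@[simp] theorem wirtingerList_cons (j : Fin d) (L : List (Fin d)) (f : (Fin d → ℂ) → ℂ) :
    wirtingerList (j :: L) f = wirtinger j (wirtingerList L f) := rfl

theorem wirtingerList_concat (L : List (Fin d)) (j : Fin d) (f : (Fin d → ℂ) → ℂ) :
    wirtingerList (L ++ [j]) f = wirtingerList L (wirtinger j f) := by
  simp [wirtingerList, List.foldr_append]

/-- The list of coordinates in which `j` occurs `k j` times. -/
def indexList (k : Fin d → ℕ) : List (Fin d) :=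
  (List.finRange d).flatMap fun j => List.replicate (k j) j

theorem wirtingerPow_eq_wirtingerList (k : Fin d → ℕ) (f : (Fin d → ℂ) → ℂ) :
    wirtingerPow k f = wirtingerList (indexList k) f := by
  have h : ∀ (n : ℕ) (j : Fin d) (g : (Fin d → ℂ) → ℂ),
      (wirtinger j)^[n] g = (List.replicate n j).foldr wirtinger g := by
    intro n j g
    induction n with
    | zero => rfl
    | succ n ih => rw [Function.iterate_succ_apply', ih]; rfl
  simp only [wirtingerPow, wirtingerList, indexList, List.foldr_flatMap, h]

theorem IsSmooth.wirtingerList {f : (Fin d → ℂ) → ℂ} (hf : IsSmooth f) (L : List (Fin d)) :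
    IsSmooth (wirtingerList L f) := by
  induction L with
  | nil => exact hf
  | cons j L ih => exact IsSmooth.wirtinger ih j

theorem wirtingerList_add {f g : (Fin d → ℂ) → ℂ} (hf : IsSmooth f) (hg : IsSmooth g)
    (L : List (Fin d)) :
    wirtingerList L (fun v => f v + g v)
      = fun v => wirtingerList L f v + wirtingerList L g v := by
  induction L with
  | nil => rfl
  | cons j L ih =>
    funext z
    rw [wirtingerList_cons, ih, wirtinger_add ((hf.wirtingerList L).differentiableAt z)
      ((hg.wirtingerList L).differentiableAt z)]
    rfl

/-- Smooth functions annihilated by all derivatives `∂/∂z_j`. -/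
def IsAntiholomorphic (W : (Fin d → ℂ) → ℂ) : Prop :=
  IsSmooth W ∧ ∀ j z, wirtinger j W z = 0

/-- In each Leibniz step the term that differentiates `W` vanishes, so antiholomorphic factors
behave as constants. -/
theorem wirtingerList_mul {W f : (Fin d → ℂ) → ℂ} (hW : IsAntiholomorphic W) (hf : IsSmooth f)
    (L : List (Fin d)) :
    wirtingerList L (fun v => W v * f v) = fun v => W v * wirtingerList L f v := by
  induction L with
  | nil => rfl
  | cons j L ih =>
    funext z
    rw [wirtingerList_cons, ih, wirtinger_mul (hW.1.differentiableAt z)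
      ((hf.wirtingerList L).differentiableAt z), hW.2, zero_mul, zero_add]
    rfl

theorem wirtingerList_comp_add (f : (Fin d → ℂ) → ℂ) (a : Fin d → ℂ) (L : List (Fin d)) :
    wirtingerList L (fun v => f (v + a)) = fun v => wirtingerList L f (v + a) := by
  induction L with
  | nil => rfl
  | cons j L ih =>
    funext z
    rw [wirtingerList_cons, ih, wirtinger_comp_add]
    rfl

theorem isAntiholomorphic_const (c : ℂ) : IsAntiholomorphic (fun _ : Fin d → ℂ => c) :=
  ⟨contDiff_const, fun j z => wirtinger_const c j z⟩

theorem isAntiholomorphic_conj_coord (i : Fin d) :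
    IsAntiholomorphic (fun v : Fin d → ℂ => star (v i)) :=
  ⟨isSmooth_conj_coord i, fun j z => wirtinger_conj_coord i j z⟩

theorem IsAntiholomorphic.mul {V W : (Fin d → ℂ) → ℂ} (hV : IsAntiholomorphic V)
    (hW : IsAntiholomorphic W) : IsAntiholomorphic (fun v => V v * W v) :=
  ⟨ContDiff.mul hV.1 hW.1, fun j z => by
    rw [wirtinger_mul (hV.1.differentiableAt z) (hW.1.differentiableAt z), hV.2, hW.2]; ring⟩

theorem IsAntiholomorphic.add {V W : (Fin d → ℂ) → ℂ} (hV : IsAntiholomorphic V)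
    (hW : IsAntiholomorphic W) : IsAntiholomorphic (fun v => V v + W v) :=
  ⟨ContDiff.add hV.1 hW.1, fun j z => by
    rw [wirtinger_add (hV.1.differentiableAt z) (hW.1.differentiableAt z), hV.2, hW.2]; ring⟩

theorem IsAntiholomorphic.sum {ι : Type*} (s : Finset ι) {W : ι → (Fin d → ℂ) → ℂ}
    (hW : ∀ i ∈ s, IsAntiholomorphic (W i)) : IsAntiholomorphic (fun v => ∑ i ∈ s, W i v) :=
  ⟨ContDiff.sum fun i hi => (hW i hi).1, fun j z => by
    rw [wirtinger_sum s fun i hi => (hW i hi).1.differentiableAt z]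
    exact Finset.sum_eq_zero fun i hi => (hW i hi).2 j z⟩

theorem IsAntiholomorphic.cexp {W : (Fin d → ℂ) → ℂ} (hW : IsAntiholomorphic W) :
    IsAntiholomorphic (fun v => Complex.exp (W v)) :=
  ⟨hW.1.cexp, fun j z => by rw [wirtinger_cexp (hW.1.differentiableAt z), hW.2, mul_zero]⟩

theorem IsAntiholomorphic.list_prod {L : List (Fin d)} {W : Fin d → (Fin d → ℂ) → ℂ}
    (hW : ∀ i, IsAntiholomorphic (W i)) :
    IsAntiholomorphic (fun v => (L.map fun i => W i v).prod) := by
  induction L with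
  | nil => exact isAntiholomorphic_const 1
  | cons j L ih => simpa using (hW j).mul ih

/-- The Gaussian `e^{-π|z|²}`. -/
noncomputable def gaussian (z : Fin d → ℂ) : ℂ := (Real.exp (-(Real.pi * sqNorm z)) : ℂ)

theorem sqNorm_eq_sum (z : Fin d → ℂ) : (sqNorm z : ℂ) = ∑ i, z i * star (z i) := by
  simp [sqNorm, Complex.mul_conj']

theorem gaussian_eq_cexp :
    (gaussian : (Fin d → ℂ) → ℂ) = fun z =>
      Complex.exp (∑ i, (-(Real.pi : ℂ) * star (z i)) * z i) := by
  funext z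
  rw [gaussian, Complex.ofReal_exp]
  congr 1
  push_cast
  rw [sqNorm_eq_sum, Finset.mul_sum, ← Finset.sum_neg_distrib]
  exact Finset.sum_congr rfl fun i _ => by ring

theorem isAntiholomorphic_neg_pi_conj (i : Fin d) :
    IsAntiholomorphic (fun v : Fin d → ℂ => -(Real.pi : ℂ) * star (v i)) :=
  (isAntiholomorphic_const _).mul (isAntiholomorphic_conj_coord i)

theorem isSmooth_gaussian : IsSmooth (gaussian : (Fin d → ℂ) → ℂ) := by
  rw [gaussian_eq_cexp]
  exact IsSmooth.cexp (ContDiff.sum fun i _ =>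
    (isAntiholomorphic_neg_pi_conj i).1.mul (isSmooth_coord i))

theorem wirtinger_gaussian (j : Fin d) (z : Fin d → ℂ) :
    wirtinger j gaussian z = (-(Real.pi : ℂ) * star (z j)) * gaussian z := by
  have hs : ∀ i : Fin d, IsSmooth (fun v : Fin d → ℂ => (-(Real.pi : ℂ) * star (v i)) * v i) :=
    fun i => (isAntiholomorphic_neg_pi_conj i).1.mul (isSmooth_coord i)
  have hsum : IsSmooth (fun v : Fin d → ℂ => ∑ i, (-(Real.pi : ℂ) * star (v i)) * v i) :=
    ContDiff.sum fun i _ => hs i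
  rw [gaussian_eq_cexp, wirtinger_cexp (hsum.differentiableAt z),
    wirtinger_sum _ fun i _ => (hs i).differentiableAt z, mul_comm]
  congr 1
  rw [Finset.sum_eq_single j]
  · rw [wirtinger_mul ((isAntiholomorphic_neg_pi_conj j).1.differentiableAt z)
      ((isSmooth_coord j).differentiableAt z), (isAntiholomorphic_neg_pi_conj j).2,
      wirtinger_coord]
    simp
  · intro i _ hij
    rw [wirtinger_mul ((isAntiholomorphic_neg_pi_conj i).1.differentiableAt z)
      ((isSmooth_coord i).differentiableAt z), (isAntiholomorphic_neg_pi_conj i).2,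
      wirtinger_coord]
    simp [hij]
  · simp

/-- Iterated derivatives of the Gaussian. -/
theorem wirtingerList_gaussian (L : List (Fin d)) :
    wirtingerList L gaussian
      = fun z => (L.map fun i => -(Real.pi : ℂ) * star (z i)).prod * gaussian z := by
  induction L with
  | nil => funext z; simp
  | cons j L ih =>
    have hW := IsAntiholomorphic.list_prod (L := L) (isAntiholomorphic_neg_pi_conj (d := d))
    funext z
    rw [wirtingerList_cons, ih, wirtinger_mul (hW.1.differentiableAt z)
      (isSmooth_gaussian.differentiableAt z), hW.2, wirtinger_gaussian]
    simp only [List.map_cons, List.prod_cons]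
    ring

/-- At the origin the factor `e^{-π|z|²}` does not influence iterated `∂/∂z_j` derivatives. -/
theorem wirtingerList_gaussian_mul_zero (L : List (Fin d)) :
    ∀ {h : (Fin d → ℂ) → ℂ}, IsSmooth h →
      wirtingerList L (fun v => gaussian v * h v) 0 = wirtingerList L h 0 := by
  induction L using List.reverseRecOn with
  | nil => intro h _; simp [gaussian, sqNorm]
  | append_singleton L j ih =>
    intro h hh
    -- The innermost derivative is peeled off so that the result is again Gaussian times smooth. The
    -- extra term carries the antiholomorphic factor `star (v j)`, which passes through the other
    -- derivatives and vanishes at the origin.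
    have h1 : wirtinger j (fun v => gaussian v * h v) = fun v =>
        gaussian v * (wirtinger j h v + (-(Real.pi : ℂ) * star (v j)) * h v) := by
      funext z
      rw [wirtinger_mul (isSmooth_gaussian.differentiableAt z) (hh.differentiableAt z),
        wirtinger_gaussian]
      ring
    have h2 := (isAntiholomorphic_neg_pi_conj j).1.mul hh
    rw [wirtingerList_concat, wirtingerList_concat, h1, ih (ContDiff.add (hh.wirtinger j) h2),
      wirtingerList_add (hh.wirtinger j) h2,
      wirtingerList_mul (isAntiholomorphic_neg_pi_conj j) hh]
    simp

end WirtingerCalculus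

/-! ### Mean value property, mollification and limits of entire functions. -/

section MeanValue

variable {d : ℕ}

theorem sqNorm_nonneg (z : Fin d → ℂ) : 0 ≤ sqNorm z :=
  Finset.sum_nonneg fun _ _ => sq_nonneg _

theorem continuous_sqNorm : Continuous (sqNorm : (Fin d → ℂ) → ℝ) := by
  unfold sqNorm
  fun_prop

theorem sqNorm_smul (u : ℂ) (z : Fin d → ℂ) : sqNorm (u • z) = ‖u‖ ^ 2 * sqNorm z := by
  simp [sqNorm, mul_pow, Finset.mul_sum]

theorem contDiff_sqNorm : ContDiff ℝ ((⊤ : ℕ∞) : WithTop ℕ∞) (sqNorm : (Fin d → ℂ) → ℝ) :=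
  ContDiff.sum fun i _ => (contDiff_apply ℝ ℂ i).norm_sq ℝ

/-- A smooth rotation invariant cutoff function. -/
noncomputable def cutoff (z : Fin d → ℂ) : ℝ := Real.smoothTransition (1 - sqNorm z)

theorem contDiff_cutoff : ContDiff ℝ ((⊤ : ℕ∞) : WithTop ℕ∞) (cutoff : (Fin d → ℂ) → ℝ) :=
  Real.smoothTransition.contDiff.comp (contDiff_const.sub contDiff_sqNorm)

theorem cutoff_nonneg (z : Fin d → ℂ) : 0 ≤ cutoff z := Real.smoothTransition.nonneg _

theorem hasCompactSupport_cutoff : HasCompactSupport (cutoff : (Fin d → ℂ) → ℝ) := by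
  refine HasCompactSupport.intro (isCompact_closedBall (0 : Fin d → ℂ) 1) fun z hz => ?_
  refine Real.smoothTransition.zero_of_nonpos ?_
  by_contra! h
  refine hz (mem_closedBall_zero_iff.2 ((pi_norm_le_iff_of_nonneg zero_le_one).2 fun i => ?_))
  have h1 : ‖z i‖ ^ 2 ≤ sqNorm z :=
    Finset.single_le_sum (f := fun i => ‖z i‖ ^ 2) (fun _ _ => sq_nonneg _) (Finset.mem_univ i)
  nlinarith [norm_nonneg (z i)]

theorem cutoff_smul {u : ℂ} (hu : ‖u‖ = 1) (z : Fin d → ℂ) : cutoff (u • z) = cutoff z := by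
  simp [cutoff, sqNorm_smul, hu]

/-- A monomial weight times the cutoff function has positive integral. -/
theorem integral_monomial_mul_cutoff_pos (L : List (Fin d)) :
    0 < ∫ z : Fin d → ℂ, (L.map fun i => ‖z i‖ ^ 2).prod * cutoff z := by
  have hnn : ∀ z : Fin d → ℂ, 0 ≤ (L.map fun i => ‖z i‖ ^ 2).prod := fun z =>
    List.prod_nonneg (by simp only [List.mem_map]; rintro _ ⟨i, _, rfl⟩; positivity)
  have hcont : Continuous fun z : Fin d → ℂ => (L.map fun i => ‖z i‖ ^ 2).prod :=
    continuous_list_prod L fun i _ => by fun_prop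
  -- All coordinates of the test point are nonzero, and `d * r ^ 2 < 1` places it where the cutoff
  -- is positive, also for `d = 0`.
  let r : ℝ := (d + 1 : ℝ)⁻¹
  have hr : 0 < r := by positivity
  let z₀ : Fin d → ℂ := fun _ => (r : ℂ)
  refine Continuous.integral_pos_of_hasCompactSupport_nonneg_nonzero (x := z₀)
    (hcont.mul contDiff_cutoff.continuous) hasCompactSupport_cutoff.mul_left
    (fun z => mul_nonneg (hnn z) (cutoff_nonneg z)) (mul_ne_zero ?_ ?_)
  · refine List.prod_ne_zero ?_
    simp only [List.mem_map, not_exists, not_and]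
    intro i _
    simp [z₀, hr.ne']
  · refine (Real.smoothTransition.pos_of_pos ?_).ne'
    have h1 : sqNorm z₀ = d * r ^ 2 := by simp [sqNorm, z₀]
    have h2 : (d + 1 : ℝ) * r = 1 := mul_inv_cancel₀ (by positivity)
    have h3 : r ≤ 1 := inv_le_one_of_one_le₀ (by linarith [(Nat.cast_nonneg d : (0 : ℝ) ≤ d)])
    rw [h1]
    nlinarith

theorem measurePreserving_smul_of_norm_eq_one {u : ℂ} (hu : ‖u‖ = 1) :
    MeasurePreserving (fun z : Fin d → ℂ => u • z) := by
  have h1 : MeasurePreserving (fun x : ℂ => u * x) :=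
    (rotation ⟨u, by simp [Submonoid.unitSphere, hu]⟩).measurePreserving
  exact volume_preserving_pi (fun _ : Fin d => h1)

theorem integral_comp_smul_of_norm_eq_one {u : ℂ} (hu : ‖u‖ = 1) (f : (Fin d → ℂ) → ℂ) :
    ∫ z, f (u • z) = ∫ z, f z :=
  (measurePreserving_smul_of_norm_eq_one hu).integral_comp
    (Homeomorph.smulOfNeZero u (by rintro rfl; simp at hu)).measurableEmbedding f

/-- The mean value property of entire functions against rotation invariant weights. -/
theorem integral_mul_of_rotation_invariant {h φ : (Fin d → ℂ) → ℂ} (hh : Differentiable ℂ h)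
    (hφ : Continuous φ) (hc : HasCompactSupport φ)
    (hr : ∀ u : ℂ, ‖u‖ = 1 → ∀ z, φ (u • z) = φ z) :
    ∫ z, φ z * h z = (∫ z, φ z) * h 0 := by
  have hunit : ∀ θ : ℝ, ‖circleMap 0 1 θ‖ = 1 := fun θ => by simp
  -- Along the complex line through `z` the function is entire in one variable, so its circle
  -- average is its value at the centre. Averaging over rotations and applying Fubini then gives the
  -- claim, without polydiscs.
  have hmean : ∀ z : Fin d → ℂ,
      ∫ θ in (0 : ℝ)..2 * Real.pi, h (circleMap 0 1 θ • z) = (2 * Real.pi : ℝ) • h 0 := by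
    intro z
    have hd : Differentiable ℂ fun t : ℂ => h (t • z) := hh.comp (differentiable_id.smul_const z)
    have := DiffContOnCl.circleAverage (R := 1) (c := 0) hd.diffContOnCl
    rw [Real.circleAverage, inv_smul_eq_iff₀ (by positivity)] at this
    simpa using this
  have : IsFiniteMeasure (volume.restrict (Set.uIoc 0 (2 * Real.pi))) := by
    rw [Set.uIoc_of_le (by positivity)]
    infer_instance
  have hint : Integrable (Function.uncurry fun (θ : ℝ) (z : Fin d → ℂ) =>
      φ z * h (circleMap 0 1 θ • z))
      ((volume.restrict (Set.uIoc 0 (2 * Real.pi))).prod volume) := by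
    have hcomp : Continuous fun q : ℝ × (Fin d → ℂ) => h (circleMap 0 1 q.1 • q.2) :=
      hh.continuous.comp (((continuous_circleMap 0 1).comp continuous_fst).smul continuous_snd)
    obtain ⟨M, hM⟩ := (isCompact_Icc (a := (0 : ℝ)) (b := 2 * Real.pi)).prod hc
      |>.exists_bound_of_continuousOn hcomp.continuousOn
    have hb : Integrable (fun q : ℝ × (Fin d → ℂ) => M * ‖φ q.2‖)
        ((volume.restrict (Set.uIoc 0 (2 * Real.pi))).prod volume) :=
      (integrable_const M).mul_prod (hφ.integrable_of_hasCompactSupport hc).norm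
    refine hb.mono' ((hφ.comp continuous_snd).mul hcomp).aestronglyMeasurable ?_
    have hae : ∀ᵐ q : ℝ × (Fin d → ℂ)
        ∂((volume.restrict (Set.uIoc 0 (2 * Real.pi))).prod volume),
        q.1 ∈ Set.uIoc 0 (2 * Real.pi) :=
      Measure.quasiMeasurePreserving_fst.ae (ae_restrict_mem measurableSet_uIoc)
    filter_upwards [hae] with q hq
    rw [Set.uIoc_of_le (by positivity)] at hq
    simp only [Function.uncurry, norm_mul]
    by_cases hz : q.2 ∈ tsupport φ
    · rw [mul_comm]
      exact mul_le_mul_of_nonneg_right (hM q ⟨Set.Ioc_subset_Icc_self hq, hz⟩) (norm_nonneg _)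
    · simp [image_eq_zero_of_notMem_tsupport hz]
  have hswap := intervalIntegral_integral_swap hint
  have hl : ∀ θ : ℝ, ∫ z, φ z * h (circleMap 0 1 θ • z) = ∫ z, φ z * h z := fun θ => by
    rw [← integral_comp_smul_of_norm_eq_one (hunit θ) fun z => φ z * h z]
    simp only [hr _ (hunit θ)]
  simp only [hl, intervalIntegral.integral_const_mul, hmean] at hswap
  rw [intervalIntegral.integral_const, integral_mul_const, sub_zero, mul_smul_comm] at hswap
  exact smul_right_injective ℂ (by positivity : (2 * Real.pi : ℝ) ≠ 0) hswap

/-- A smooth, compactly supported, rotation invariant function of integral one. -/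
noncomputable def mollifier (z : Fin d → ℂ) : ℂ :=
  (∫ w : Fin d → ℂ, cutoff w : ℝ)⁻¹ * (cutoff z : ℂ)

theorem isSmooth_cutoff : IsSmooth (fun z : Fin d → ℂ => (cutoff z : ℂ)) :=
  Complex.ofRealCLM.contDiff.comp contDiff_cutoff

theorem hasCompactSupport_ofReal_cutoff :
    HasCompactSupport (fun z : Fin d → ℂ => (cutoff z : ℂ)) :=
  hasCompactSupport_cutoff.comp_left (g := Complex.ofReal) Complex.ofReal_zero

theorem isSmooth_mollifier : IsSmooth (mollifier : (Fin d → ℂ) → ℂ) :=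
  contDiff_const.mul isSmooth_cutoff

theorem hasCompactSupport_mollifier : HasCompactSupport (mollifier : (Fin d → ℂ) → ℂ) :=
  hasCompactSupport_ofReal_cutoff.mul_left

theorem mollifier_smul {u : ℂ} (hu : ‖u‖ = 1) (z : Fin d → ℂ) :
    mollifier (u • z) = mollifier z := by
  simp [mollifier, cutoff_smul hu]

theorem integral_mollifier : ∫ z : Fin d → ℂ, mollifier z = 1 := by
  have h : (∫ w : Fin d → ℂ, cutoff w) ≠ 0 := by
    simpa using (integral_monomial_mul_cutoff_pos ([] : List (Fin d))).ne'
  have h1 : ∫ z : Fin d → ℂ, (cutoff z : ℂ) = ((∫ w : Fin d → ℂ, cutoff w : ℝ) : ℂ) :=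
    integral_ofReal
  simp only [mollifier]
  rw [integral_const_mul, h1]
  rw [← Complex.ofReal_mul, inv_mul_cancel₀ h, Complex.ofReal_one]

/-- Entire functions reproduce themselves under convolution with the mollifier. -/
theorem Differentiable.eq_integral_mollifier {h : (Fin d → ℂ) → ℂ} (hh : Differentiable ℂ h)
    (a : Fin d → ℂ) : h a = ∫ t, h t * mollifier (a - t) := by
  have h1 := integral_mul_of_rotation_invariant (h := fun z => h (z + a))
    (hh.comp (differentiable_id.add_const a)) isSmooth_mollifier.continuous
    hasCompactSupport_mollifier fun u hu z => mollifier_smul hu z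
  rw [integral_mollifier, one_mul, zero_add] at h1
  rw [← h1, ← integral_add_right_eq_self (fun t => h t * mollifier (a - t)) a]
  refine integral_congr_ae (Filter.Eventually.of_forall fun z => ?_)
  -- Evenness is rotation invariance at `u = -1`; it turns the mean value formula into a
  -- convolution.
  have h2 : mollifier (-z) = mollifier z := by
    simpa using mollifier_smul (u := -1) (by simp) z
  simp only [sub_add_cancel_right, h2]
  ring

theorem integrable_mul_comp_sub {f g : (Fin d → ℂ) → ℂ} (hf : LocallyIntegrable f volume)
    (hg : Continuous g) (hc : HasCompactSupport g) (x : Fin d → ℂ) :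
    Integrable (fun t => f t * g (x - t)) volume :=
  hc.convolutionExists_right (ContinuousLinearMap.mul ℝ ℂ) hf hg x

/-- All derivatives fall on the test function, so `f` need only be locally integrable; this is what
allows passing to limits of `f`. -/
theorem hasFDerivAt_integral_mul_comp_sub {f g : (Fin d → ℂ) → ℂ}
    (hf : LocallyIntegrable f volume) (hg : IsSmooth g) (hc : HasCompactSupport g)
    (x : Fin d → ℂ) :
    ∃ A : (Fin d → ℂ) →L[ℝ] ℂ, HasFDerivAt (fun y => ∫ t, f t * g (y - t)) A x ∧
      ∀ v, A v = ∫ t, f t * fderiv ℝ g (x - t) v := by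
  have hg1 : ContDiff ℝ 1 g := hg.of_le (by exact_mod_cast le_top)
  refine ⟨_, hc.hasFDerivAt_convolution_right (ContinuousLinearMap.mul ℝ ℂ) hf hg1 x,
    fun v => ?_⟩
  rw [convolution_precompR_apply _ hf (hc.fderiv ℝ) (hg1.continuous_fderiv one_ne_zero)]
  rfl

theorem isSmooth_integral_mul_comp_sub {f g : (Fin d → ℂ) → ℂ}
    (hf : LocallyIntegrable f volume) (hg : IsSmooth g) (hc : HasCompactSupport g) :
    IsSmooth (fun y => ∫ t, f t * g (y - t)) :=
  hc.contDiff_convolution_right (ContinuousLinearMap.mul ℝ ℂ) hf hg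

theorem HasCompactSupport.wirtinger {g : (Fin d → ℂ) → ℂ} (hc : HasCompactSupport g)
    (j : Fin d) : HasCompactSupport (wirtinger j g) :=
  (hc.fderiv ℝ).comp_left (g := fun A : (Fin d → ℂ) →L[ℝ] ℂ =>
    (A (Pi.single j 1) - Complex.I * A (Pi.single j Complex.I)) / 2) (by simp)

theorem HasCompactSupport.wirtingerList {g : (Fin d → ℂ) → ℂ} (hc : HasCompactSupport g)
    (L : List (Fin d)) : HasCompactSupport (wirtingerList L g) := by
  induction L with
  | nil => exact hc
  | cons j L ih => exact HasCompactSupport.wirtinger ih j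

theorem wirtinger_integral_mul_comp_sub {f g : (Fin d → ℂ) → ℂ}
    (hf : LocallyIntegrable f volume) (hg : IsSmooth g) (hc : HasCompactSupport g) (j : Fin d)
    (x : Fin d → ℂ) :
    wirtinger j (fun y => ∫ t, f t * g (y - t)) x = ∫ t, f t * wirtinger j g (x - t) := by
  obtain ⟨A, hA, hAv⟩ := hasFDerivAt_integral_mul_comp_sub hf hg hc x
  have hint : ∀ v, Integrable (fun t => f t * fderiv ℝ g (x - t) v) volume := fun v =>
    integrable_mul_comp_sub hf (ContDiff.continuous (n := ((⊤ : ℕ∞) : WithTop ℕ∞))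
      ((hg.fderiv_right (by simp)).clm_apply contDiff_const)) (hc.fderiv_apply ℝ v) x
  rw [hA.wirtinger_eq, hAv, hAv, ← integral_const_mul, ← integral_sub (hint _)
    ((hint _).const_mul _), ← integral_div]
  refine integral_congr_ae (Filter.Eventually.of_forall fun t => ?_)
  simp only [wirtinger]
  ring

theorem wirtingerList_integral_mul_comp_sub {f g : (Fin d → ℂ) → ℂ}
    (hf : LocallyIntegrable f volume) (hg : IsSmooth g) (hc : HasCompactSupport g)
    (L : List (Fin d)) :
    wirtingerList L (fun y => ∫ t, f t * g (y - t))
      = fun x => ∫ t, f t * wirtingerList L g (x - t) := by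
  induction L with
  | nil => rfl
  | cons j L ih =>
    funext x
    rw [wirtingerList_cons, ih, wirtinger_integral_mul_comp_sub hf (hg.wirtingerList L)
      (hc.wirtingerList L)]
    rfl

theorem Differentiable.isSmooth {h : (Fin d → ℂ) → ℂ} (hh : Differentiable ℂ h) :
    IsSmooth h := by
  rw [show h = fun a => ∫ t, h t * mollifier (a - t) from funext hh.eq_integral_mollifier]
  exact isSmooth_integral_mul_comp_sub hh.continuous.locallyIntegrable isSmooth_mollifier
    hasCompactSupport_mollifier

theorem Differentiable.wirtingerList_eq {h : (Fin d → ℂ) → ℂ} (hh : Differentiable ℂ h)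
    (L : List (Fin d)) (a : Fin d → ℂ) :
    wirtingerList L h a = ∫ t, h t * wirtingerList L mollifier (a - t) := by
  conv_lhs => rw [show h = fun a => ∫ t, h t * mollifier (a - t) from
    funext hh.eq_integral_mollifier]
  rw [wirtingerList_integral_mul_comp_sub hh.continuous.locallyIntegrable isSmooth_mollifier
    hasCompactSupport_mollifier]

/-- A pointwise limit of locally uniformly bounded entire functions is entire. -/
theorem differentiable_of_tendsto {G : ℕ → (Fin d → ℂ) → ℂ} {g : (Fin d → ℂ) → ℂ}
    {M : (Fin d → ℂ) → ℝ} (hG : ∀ n, Differentiable ℂ (G n)) (hM : Continuous M)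
    (hb : ∀ n z, ‖G n z‖ ≤ M z)
    (hlim : ∀ z, Filter.Tendsto (fun n => G n z) Filter.atTop (nhds (g z))) :
    Differentiable ℂ g := by
  have hgm : AEStronglyMeasurable g volume :=
    aestronglyMeasurable_of_tendsto_ae Filter.atTop
      (fun n => (hG n).continuous.aestronglyMeasurable) (Filter.Eventually.of_forall hlim)
  have hgb : ∀ z, ‖g z‖ ≤ M z := fun z =>
    le_of_tendsto (hlim z).norm (Filter.Eventually.of_forall fun n => hb n z)
  have hg : LocallyIntegrable g volume :=
    hM.locallyIntegrable.mono hgm (Filter.Eventually.of_forall fun z =>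
      (hgb z).trans (le_abs_self _))
  have hconv : ∀ (φ : (Fin d → ℂ) → ℂ), Continuous φ → HasCompactSupport φ → ∀ x,
      Filter.Tendsto (fun n => ∫ t, G n t * φ (x - t)) Filter.atTop
        (nhds (∫ t, g t * φ (x - t))) := by
    intro φ hφ hφc x
    have hi := integrable_mul_comp_sub (f := fun t => (M t : ℂ))
      (Complex.continuous_ofReal.comp hM).locallyIntegrable hφ hφc x
    refine tendsto_integral_of_dominated_convergence (fun t => ‖(M t : ℂ) * φ (x - t)‖)
      (fun n => ((hG n).continuous.mul (hφ.comp (continuous_const.sub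
        continuous_id))).aestronglyMeasurable) hi.norm (fun n => ?_) ?_
    · refine Filter.Eventually.of_forall fun t => ?_
      rw [norm_mul, norm_mul]
      refine mul_le_mul_of_nonneg_right ((hb n t).trans ?_) (norm_nonneg _)
      simpa using le_abs_self (M t)
    · exact Filter.Eventually.of_forall fun t => (hlim t).mul_const _
  -- The reproducing formula survives the limit, so `g` is real differentiable although only
  -- pointwise convergence is given.
  have hrep : g = fun a => ∫ t, g t * mollifier (a - t) := by
    funext a
    refine tendsto_nhds_unique (hlim a) ?_
    simp only [fun n => (hG n).eq_integral_mollifier a]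
    exact hconv _ isSmooth_mollifier.continuous hasCompactSupport_mollifier a
  intro a
  obtain ⟨A, hA, hAv⟩ := hasFDerivAt_integral_mul_comp_sub hg isSmooth_mollifier
    hasCompactSupport_mollifier a
  rw [← hrep] at hA
  have hAlim : ∀ v, Filter.Tendsto (fun n => fderiv ℂ (G n) a v) Filter.atTop (nhds (A v)) := by
    intro v
    have h1 : ∀ n, fderiv ℂ (G n) a v = ∫ t, G n t * fderiv ℝ mollifier (a - t) v := by
      intro n
      obtain ⟨B, hB, hBv⟩ := hasFDerivAt_integral_mul_comp_sub
        (hG n).continuous.locallyIntegrable isSmooth_mollifier hasCompactSupport_mollifier a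
      rw [← funext (hG n).eq_integral_mollifier] at hB
      rw [← hBv, hB.unique ((hG n a).hasFDerivAt.restrictScalars ℝ)]
      rfl
    simp only [h1, hAv]
    exact hconv _ (ContDiff.continuous (n := ((⊤ : ℕ∞) : WithTop ℕ∞))
      ((ContDiff.fderiv_right isSmooth_mollifier (by simp)).clm_apply contDiff_const))
      (hasCompactSupport_mollifier.fderiv_apply ℝ v) a
  -- The real derivative `A` is a pointwise limit of complex-linear maps, hence complex-linear.
  rw [differentiableAt_iff_restrictScalars ℝ hA.differentiableAt, hA.fderiv]
  refine ⟨{ toFun := A, map_add' := A.map_add, map_smul' := fun c v => ?_, cont := A.cont },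
    rfl⟩
  refine tendsto_nhds_unique (hAlim (c • v)) ?_
  simpa using (hAlim v).const_mul c

end MeanValue

/-! ### `polyRaise`, Weyl translations and the two integral formulas. -/

section PolyRaise

variable {d : ℕ}

/-- The inverse Gaussian `e^{π|z|²}`. -/
noncomputable def gaussianInv (z : Fin d → ℂ) : ℂ := (Real.exp (Real.pi * sqNorm z) : ℂ)

theorem gaussianInv_mul_gaussian (z : Fin d → ℂ) : gaussianInv z * gaussian z = 1 := by
  rw [gaussianInv, gaussian, ← Complex.ofReal_mul, ← Real.exp_add]
  simp

theorem isSmooth_gaussianInv : IsSmooth (gaussianInv : (Fin d → ℂ) → ℂ) :=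
  Complex.ofRealCLM.contDiff.comp (Real.contDiff_exp.comp (contDiff_const.mul contDiff_sqNorm))

theorem polyRaise_eq (k : Fin d → ℕ) (G : (Fin d → ℂ) → ℂ) :
    polyRaise k G = fun z =>
      gaussianInv z * wirtingerList (indexList k) (fun v => gaussian v * G v) z := by
  funext z
  rw [← wirtingerPow_eq_wirtingerList]
  rfl

theorem isSmooth_polyRaise (k : Fin d → ℕ) {G : (Fin d → ℂ) → ℂ} (hG : IsSmooth G) :
    IsSmooth (polyRaise k G) := by
  rw [polyRaise_eq]
  exact ContDiff.mul isSmooth_gaussianInv (IsSmooth.wirtingerList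
    (ContDiff.mul isSmooth_gaussian hG) _)

theorem polyRaise_zero (k : Fin d → ℕ) {h : (Fin d → ℂ) → ℂ} (hh : IsSmooth h) :
    polyRaise k h 0 = wirtingerList (indexList k) h 0 := by
  simp only [polyRaise_eq, wirtingerList_gaussian_mul_zero _ hh]
  simp [gaussianInv, sqNorm]

/-- The (unnormalised) Weyl translation `z ↦ e^{-π z·ā} h(z + a)`. -/
noncomputable def weylShift (a : Fin d → ℂ) (h : (Fin d → ℂ) → ℂ) (z : Fin d → ℂ) : ℂ :=
  Complex.exp (∑ i, (-(Real.pi : ℂ) * star (a i)) * z i) * h (z + a)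

theorem weylShift_zero (a : Fin d → ℂ) (h : (Fin d → ℂ) → ℂ) : weylShift a h 0 = h a := by
  simp [weylShift]

theorem differentiable_weylShift (a : Fin d → ℂ) {h : (Fin d → ℂ) → ℂ}
    (hh : Differentiable ℂ h) : Differentiable ℂ (weylShift a h) := by
  have h1 : Differentiable ℂ fun z => h (z + a) := hh.comp (differentiable_id.add_const a)
  have h2 : Differentiable ℂ fun z : Fin d → ℂ =>
      ∑ i, (-(Real.pi : ℂ) * star (a i)) * z i := by fun_prop
  exact h2.cexp.mul h1

/-- The operator `polyRaise` commutes with Weyl translations. -/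
theorem polyRaise_weylShift (k : Fin d → ℕ) (a : Fin d → ℂ) {G : (Fin d → ℂ) → ℂ}
    (hG : IsSmooth G) : polyRaise k (weylShift a G) = weylShift a (polyRaise k G) := by
  -- Expanding `|v + a|²` gives `e^{-π|v|²} e^{-π v·ā} = W(v) e^{-π|v+a|²}` with `W(v) = e^{π|a|² +
  -- π a·v̄}`. This factor is antiholomorphic, so it commutes with `∂^k`.
  let W : (Fin d → ℂ) → ℂ := fun v => Complex.exp
    ((∑ i, (Real.pi : ℂ) * a i * star (a i)) + ∑ i, (Real.pi : ℂ) * a i * star (v i))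
  have hW : IsAntiholomorphic W := IsAntiholomorphic.cexp ((isAntiholomorphic_const _).add
    (IsAntiholomorphic.sum _ fun i _ =>
      (isAntiholomorphic_const _).mul (isAntiholomorphic_conj_coord i)))
  have h1 : (fun v => gaussian v * weylShift a G v)
      = fun v => W v * (gaussian (v + a) * G (v + a)) := by
    funext v
    simp only [gaussian_eq_cexp, weylShift, W]
    rw [← mul_assoc, ← mul_assoc, ← Complex.exp_add, ← Complex.exp_add,
      ← Finset.sum_add_distrib, ← Finset.sum_add_distrib, ← Finset.sum_add_distrib]
    congr 2
    refine Finset.sum_congr rfl fun i _ => ?_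
    simp only [Pi.add_apply, star_add]
    ring
  have hE : ∀ v : Fin d → ℂ,
      gaussianInv v = Complex.exp (∑ i, (Real.pi : ℂ) * (v i * star (v i))) := by
    intro v
    rw [gaussianInv, Complex.ofReal_exp, Complex.ofReal_mul, sqNorm_eq_sum, Finset.mul_sum]
  have h2 : IsSmooth fun v => gaussian (v + a) * G (v + a) :=
    IsSmooth.comp_add (f := fun v => gaussian v * G v) (ContDiff.mul isSmooth_gaussian hG) a
  funext z
  simp only [polyRaise_eq, h1, wirtingerList_mul hW h2]
  rw [weylShift, wirtingerList_comp_add (fun v => gaussian v * G v) a, ← mul_assoc, ← mul_assoc]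
  congr 1
  simp only [hE, W]
  rw [← Complex.exp_add, ← Complex.exp_add, ← Finset.sum_add_distrib,
      ← Finset.sum_add_distrib, ← Finset.sum_add_distrib]
  congr 1
  refine Finset.sum_congr rfl fun i _ => ?_
  simp only [Pi.add_apply, star_add]
  ring

/-- `polyRaise k` acts on entire functions as a twisted convolution with a test function. -/
theorem exists_polyRaise_eq_integral (k : Fin d → ℕ) :
    ∃ Q : (Fin d → ℂ) → ℂ, Continuous Q ∧ HasCompactSupport Q ∧
      ∀ G : (Fin d → ℂ) → ℂ, Differentiable ℂ G →
        ∀ a, polyRaise k G a = ∫ z, Q z * weylShift a G z := by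
  have hs := isSmooth_mollifier.wirtingerList (d := d) (indexList k)
  have hc := hasCompactSupport_mollifier.wirtingerList (d := d) (indexList k)
  -- The derivative at the origin is an integral against the derivative of the mollifier at `0 - z`,
  -- hence the reflection.
  refine ⟨fun z => wirtingerList (indexList k) mollifier (-z), hs.continuous.comp continuous_neg,
    hc.comp_homeomorph (Homeomorph.neg _), fun G hG a => ?_⟩
  have hd := differentiable_weylShift a hG
  rw [← weylShift_zero a (polyRaise k G), ← polyRaise_weylShift k a hG.isSmooth,
    polyRaise_zero k hd.isSmooth, hd.wirtingerList_eq]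
  simp only [zero_sub, mul_comm]

/-- Complex dilations are holomorphic, so no `∂/∂z̄` term enters the chain rule. Each `∂/∂z_j`
therefore lowers the rotation weight of a function by one. -/
theorem wirtinger_comp_smul {P : (Fin d → ℂ) → ℂ} (hP : IsSmooth P) (u : ℂ) (j : Fin d)
    (z : Fin d → ℂ) : wirtinger j (fun v => P (u • v)) z = u * wirtinger j P (u • z) := by
  have hlin : HasFDerivAt (fun v : Fin d → ℂ => u • v)
      (u • ContinuousLinearMap.id ℝ (Fin d → ℂ)) z :=
    (hasFDerivAt_id (𝕜 := ℝ) z).const_smul u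
  have hcomp : HasFDerivAt (fun v : Fin d → ℂ => P (u • v))
      ((fderiv ℝ P (u • z)).comp (u • ContinuousLinearMap.id ℝ (Fin d → ℂ))) z :=
    (hP.differentiableAt (u • z)).hasFDerivAt.comp z hlin
  rw [hcomp.wirtinger_eq, wirtinger]
  set A := fderiv ℝ P (u • z)
  have h1 : u • (Pi.single j 1 : Fin d → ℂ)
      = u.re • (Pi.single j 1 : Fin d → ℂ) + u.im • (Pi.single j Complex.I : Fin d → ℂ) := by
    rw [← Pi.single_smul, ← Pi.single_smul, ← Pi.single_smul, ← Pi.single_add]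
    congr 1
    simp [Complex.re_add_im]
  have h2 : u • (Pi.single j Complex.I : Fin d → ℂ)
      = u.re • (Pi.single j Complex.I : Fin d → ℂ) - u.im • (Pi.single j 1 : Fin d → ℂ) := by
    rw [← Pi.single_smul, ← Pi.single_smul, ← Pi.single_smul, ← Pi.single_sub]
    congr 1
    apply Complex.ext <;> simp
  simp only [ContinuousLinearMap.comp_apply, smul_apply, ContinuousLinearMap.id_apply, h1, h2,
    map_add, map_sub, map_smul, Complex.real_smul]
  conv_rhs => rw [← Complex.re_add_im u]
  linear_combination (u.im * A (Pi.single j Complex.I) / 2 : ℂ) * Complex.I_sq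

/-- Integration by parts for the Wirtinger derivative. -/
theorem integral_mul_wirtinger {P f : (Fin d → ℂ) → ℂ} (hP : IsSmooth P)
    (hc : HasCompactSupport P) (hf : IsSmooth f) (j : Fin d) :
    ∫ z, P z * wirtinger j f z = ∫ z, -wirtinger j P z * f z := by
  have hcd : ∀ {g : (Fin d → ℂ) → ℂ}, IsSmooth g → ∀ v, Continuous fun z => fderiv ℝ g z v :=
    fun hg v => ContDiff.continuous (n := ((⊤ : ℕ∞) : WithTop ℕ∞))
      ((ContDiff.fderiv_right hg (by simp)).clm_apply contDiff_const)
  have hi1 : ∀ v, Integrable (fun z => fderiv ℝ P z v * f z) volume := fun v =>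
    ((hcd hP v).mul hf.continuous).integrable_of_hasCompactSupport (hc.fderiv_apply ℝ v).mul_right
  have hi2 : ∀ v, Integrable (fun z => P z * fderiv ℝ f z v) volume := fun v =>
    (hP.continuous.mul (hcd hf v)).integrable_of_hasCompactSupport hc.mul_right
  have hi3 : Integrable (fun z => P z * f z) volume :=
    (hP.continuous.mul hf.continuous).integrable_of_hasCompactSupport hc.mul_right
  have key : ∀ v, ∫ z, P z * fderiv ℝ f z v = -∫ z, fderiv ℝ P z v * f z := fun v =>
    integral_mul_fderiv_eq_neg_fderiv_mul_of_integrable (hi1 v) (hi2 v) hi3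
      (fun x _ => hP.differentiableAt x) fun x _ => hf.differentiableAt x
  have e1 : ∀ z, P z * wirtinger j f z = (P z * fderiv ℝ f z (Pi.single j 1)
      - Complex.I * (P z * fderiv ℝ f z (Pi.single j Complex.I))) / 2 := fun z => by
    rw [wirtinger]; ring
  have e2 : ∀ z, -wirtinger j P z * f z = -((fderiv ℝ P z (Pi.single j 1) * f z
      - Complex.I * (fderiv ℝ P z (Pi.single j Complex.I) * f z)) / 2) := fun z => by
    rw [wirtinger]; ring
  simp only [e1, e2]
  rw [integral_neg, integral_div, integral_div, integral_sub (hi2 _) ((hi2 _).const_mul _),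
    integral_sub (hi1 _) ((hi1 _).const_mul _), integral_const_mul, integral_const_mul, key, key]
  ring

/-- Each integration by parts moves one derivative onto `P` and lowers its rotation weight by one.
The initial weight equals the number of derivatives, so the final weight function is rotation
invariant. -/
theorem exists_integral_mul_wirtingerList (L : List (Fin d)) :
    ∀ P : (Fin d → ℂ) → ℂ, IsSmooth P → HasCompactSupport P →
      (∀ u : ℂ, ‖u‖ = 1 → ∀ z, P (u • z) = u ^ L.length * P z) →
      ∃ P' : (Fin d → ℂ) → ℂ, IsSmooth P' ∧ HasCompactSupport P' ∧
        (∀ u : ℂ, ‖u‖ = 1 → ∀ z, P' (u • z) = P' z) ∧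
        ∀ f, IsSmooth f → ∫ z, P z * wirtingerList L f z = ∫ z, P' z * f z := by
  induction L with
  | nil => exact fun P hP hc hw => ⟨P, hP, hc, by simpa using hw, fun f _ => rfl⟩
  | cons j L ih =>
    intro P hP hc hw
    obtain ⟨P', h1, h2, h3, h4⟩ := ih (fun z => -wirtinger j P z) (hP.wirtinger j).neg
      (hc.wirtinger j).neg fun u hu z => by
        have hu0 : u ≠ 0 := by rintro rfl; simp at hu
        have e : wirtinger j (fun v => P (u • v)) z = u ^ (j :: L).length * wirtinger j P z := by
          rw [funext (hw u hu), wirtinger_mul (differentiableAt_const _) (hP.differentiableAt z),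
            wirtinger_const]
          ring
        rw [wirtinger_comp_smul hP, List.length_cons, pow_succ', mul_assoc] at e
        rw [mul_left_cancel₀ hu0 e]
        ring
    refine ⟨P', h1, h2, h3, fun f hf => ?_⟩
    rw [← h4 f hf, wirtingerList_cons, integral_mul_wirtinger hP hc (hf.wirtingerList L)]

/-- An entire function `G` is recovered from `polyRaise k G` by a twisted convolution with a test
function. -/
theorem exists_integral_polyRaise_eq (k : Fin d → ℕ) :
    ∃ P : (Fin d → ℂ) → ℂ, Continuous P ∧ HasCompactSupport P ∧
      ∀ G : (Fin d → ℂ) → ℂ, Differentiable ℂ G →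
        ∀ a, G a = ∫ z, P z * weylShift a (polyRaise k G) z := by
  set L := indexList k with hL
  -- The monomial `z^k` has rotation weight `|k|`, exactly what the derivatives in `polyRaise k`
  -- consume.
  let P : (Fin d → ℂ) → ℂ := fun z => (L.map fun i => z i).prod * (cutoff z : ℂ)
  have hPs : IsSmooth P := by
    refine ContDiff.mul ?_ isSmooth_cutoff
    generalize L = L'
    induction L' with
    | nil => exact contDiff_const
    | cons j L ih => simpa using (isSmooth_coord j).mul ih
  have hPc : HasCompactSupport P := hasCompactSupport_ofReal_cutoff.mul_left
  have hPw : ∀ u : ℂ, ‖u‖ = 1 → ∀ z, P (u • z) = u ^ L.length * P z := by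
    intro u hu z
    have : (L.map fun i => (u • z) i).prod = u ^ L.length * (L.map fun i => z i).prod := by
      simp [List.prod_map_mul]
    simp only [P, this, cutoff_smul hu, mul_assoc]
  obtain ⟨P', h1, h2, h3, h4⟩ := exists_integral_mul_wirtingerList L
    (fun z => P z * gaussianInv z) (ContDiff.mul hPs isSmooth_gaussianInv) hPc.mul_right
    fun u hu z => by
      simp only [hPw u hu, gaussianInv, sqNorm_smul, hu]
      ring_nf
  set c : ℂ := ∫ z, P' z * gaussian z with hc
  have key : ∀ h : (Fin d → ℂ) → ℂ, Differentiable ℂ h →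
      ∫ z, P z * polyRaise k h z = c * h 0 := by
    intro h hh
    simp only [polyRaise_eq, ← mul_assoc]
    rw [h4 _ (ContDiff.mul isSmooth_gaussian hh.isSmooth)]
    simp only [← mul_assoc]
    refine integral_mul_of_rotation_invariant hh (h1.continuous.mul isSmooth_gaussian.continuous)
      h2.mul_right fun u hu z => ?_
    rw [h3 u hu]
    simp [gaussian, sqNorm_smul, hu]
  -- For `G = 1` one has `polyRaise k 1 = (-π)^{|k|} z̄^k`. Paired with `z^k` times the cutoff it
  -- gives a nonzero multiple of a positive integral.
  have hc0 : c ≠ 0 := by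
    have h5 := key (fun _ => 1) (differentiable_const _)
    have h6 : ∀ z, P z * polyRaise k (fun _ => 1) z = (-(Real.pi : ℂ)) ^ L.length *
        (((L.map fun i => ‖z i‖ ^ 2).prod * cutoff z : ℝ) : ℂ) := by
      intro z
      simp only [polyRaise_eq, mul_one, P]
      rw [show (fun v : Fin d → ℂ => gaussian v) = gaussian from rfl, wirtingerList_gaussian]
      have h7 : (L.map fun i => z i).prod * (L.map fun i => -(Real.pi : ℂ) * star (z i)).prod
          = (-(Real.pi : ℂ)) ^ L.length * (((L.map fun i => ‖z i‖ ^ 2).prod : ℝ) : ℂ) := by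
        generalize L = L'
        induction L' with
        | nil => simp
        | cons j L ih =>
          simp only [List.map_cons, List.prod_cons, List.length_cons, Complex.ofReal_mul,
            Complex.ofReal_pow]
          have h8 : z j * star (z j) = (‖z j‖ : ℂ) ^ 2 := Complex.mul_conj' (z j)
          linear_combination (-(Real.pi : ℂ) * (z j * star (z j))) * ih
            - (Real.pi : ℂ) * ((-(Real.pi : ℂ)) ^ L.length *
              (((L.map fun i => ‖z i‖ ^ 2).prod : ℝ) : ℂ)) * h8
      rw [Complex.ofReal_mul]
      linear_combination (cutoff z : ℂ) * h7 + (cutoff z : ℂ) * (L.map fun i => z i).prod *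
        (L.map fun i => -(Real.pi : ℂ) * star (z i)).prod * gaussianInv_mul_gaussian z
    have h9 : ∫ z : Fin d → ℂ, (((L.map fun i => ‖z i‖ ^ 2).prod * cutoff z : ℝ) : ℂ)
        = ((∫ z : Fin d → ℂ, (L.map fun i => ‖z i‖ ^ 2).prod * cutoff z : ℝ) : ℂ) :=
      integral_ofReal
    simp only [h6, mul_one] at h5
    rw [integral_const_mul, h9] at h5
    rw [← h5]
    exact mul_ne_zero (pow_ne_zero _ (by simp [Real.pi_ne_zero]))
      (by exact_mod_cast (integral_monomial_mul_cutoff_pos L).ne')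
  refine ⟨fun z => c⁻¹ * P z, continuous_const.mul hPs.continuous, hPc.mul_left,
    fun G hG a => ?_⟩
  simp only [mul_assoc]
  rw [integral_const_mul, ← polyRaise_weylShift k a hG.isSmooth,
    key _ (differentiable_weylShift a hG), weylShift_zero, inv_mul_cancel_left₀ hc0]

end PolyRaise

/-! ### Weighted bounds, closure under bounded limits, and approximation. -/

section Closure

variable {d : ℕ}

theorem norm_gaussWeighted (F : (Fin d → ℂ) → ℂ) (z : Fin d → ℂ) :
    ‖gaussWeighted F z‖ = ‖F z‖ * Real.exp (-(Real.pi * sqNorm z / 2)) := by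
  rw [gaussWeighted, norm_mul, Complex.norm_real, Real.norm_of_nonneg (Real.exp_nonneg _)]

theorem norm_eq_exp_mul_norm_gaussWeighted (F : (Fin d → ℂ) → ℂ) (z : Fin d → ℂ) :
    ‖F z‖ = Real.exp (Real.pi * sqNorm z / 2) * ‖gaussWeighted F z‖ := by
  rw [norm_gaussWeighted, mul_left_comm, ← Real.exp_add]
  simp

theorem continuous_gaussWeighted {F : (Fin d → ℂ) → ℂ} (hF : Continuous F) :
    Continuous (gaussWeighted F) :=
  hF.mul (Complex.continuous_ofReal.comp (Real.continuous_exp.comp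
    ((continuous_const.mul continuous_sqNorm).div_const _).neg))

theorem sqNorm_add (z a : Fin d → ℂ) :
    sqNorm (z + a) = sqNorm z + sqNorm a + 2 * ∑ i, (star (a i) * z i).re := by
  simp only [sqNorm, Finset.mul_sum, ← Finset.sum_add_distrib]
  refine Finset.sum_congr rfl fun i _ => ?_
  simp only [← Complex.normSq_eq_norm_sq, Complex.normSq_apply, Pi.add_apply, Complex.add_re,
    Complex.add_im, Complex.mul_re, Complex.star_def, Complex.conj_re, Complex.conj_im]
  ring

/-- The modulus of the exponential cancels the cross term of `|z + a|²`. The weight in `a` thus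
separates from the one in `z`, and the latter is harmless on compact supports. -/
theorem norm_weylShift (a : Fin d → ℂ) (F : (Fin d → ℂ) → ℂ) (z : Fin d → ℂ) :
    ‖weylShift a F z‖ = Real.exp (Real.pi * sqNorm a / 2) *
      (Real.exp (Real.pi * sqNorm z / 2) * ‖gaussWeighted F (z + a)‖) := by
  have h : (∑ i, (-(Real.pi : ℂ) * star (a i)) * z i).re
      = -(Real.pi * ∑ i, (star (a i) * z i).re) := by
    rw [Complex.re_sum, Finset.mul_sum, ← Finset.sum_neg_distrib]
    refine Finset.sum_congr rfl fun i _ => ?_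
    rw [mul_assoc, neg_mul, Complex.neg_re, Complex.re_ofReal_mul]
  rw [weylShift, norm_mul, Complex.norm_exp, h, norm_eq_exp_mul_norm_gaussWeighted F, sqNorm_add,
    ← mul_assoc, ← mul_assoc, ← Real.exp_add, ← Real.exp_add]
  congr 2
  ring

/-- The weighted bound for a twisted convolution. -/
theorem norm_gaussWeighted_integral_le (R F : (Fin d → ℂ) → ℂ) (a : Fin d → ℂ) :
    ‖gaussWeighted (fun a => ∫ z, R z * weylShift a F z) a‖
      ≤ ∫ z, ‖R z‖ * Real.exp (Real.pi * sqNorm z / 2) * ‖gaussWeighted F (z + a)‖ := by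
  have h : ∀ z, ‖R z * weylShift a F z‖ = Real.exp (Real.pi * sqNorm a / 2) *
      (‖R z‖ * Real.exp (Real.pi * sqNorm z / 2) * ‖gaussWeighted F (z + a)‖) := fun z => by
    rw [norm_mul, norm_weylShift]; ring
  rw [norm_gaussWeighted]
  calc _ ≤ (∫ z, ‖R z * weylShift a F z‖) * Real.exp (-(Real.pi * sqNorm a / 2)) :=
        mul_le_mul_of_nonneg_right (norm_integral_le_integral_norm _) (Real.exp_nonneg _)
    _ = _ := by
        simp only [h]
        rw [integral_const_mul, mul_right_comm, ← Real.exp_add]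
        simp

theorem continuous_exp_sqNorm (c : ℝ) :
    Continuous fun z : Fin d → ℂ => Real.exp (c * sqNorm z / 2) :=
  Real.continuous_exp.comp ((continuous_const.mul continuous_sqNorm).div_const _)

theorem integrable_norm_mul_exp_sqNorm {R : (Fin d → ℂ) → ℂ} (hR : Continuous R)
    (hc : HasCompactSupport R) (c : ℝ) :
    Integrable (fun z => ‖R z‖ * Real.exp (c * sqNorm z / 2)) volume :=
  (hR.norm.mul (continuous_exp_sqNorm c)).integrable_of_hasCompactSupport hc.norm.mul_right

theorem ae_comp_add_right {p : (Fin d → ℂ) → Prop} (h : ∀ᵐ z ∂(volume : Measure (Fin d → ℂ)), p z)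
    (a : Fin d → ℂ) : ∀ᵐ z ∂(volume : Measure (Fin d → ℂ)), p (z + a) :=
  (measurePreserving_add_right volume a).quasiMeasurePreserving.ae h

theorem norm_gaussWeighted_integral_le_of_bound {R F : (Fin d → ℂ) → ℂ} (hR : Continuous R)
    (hc : HasCompactSupport R) {C : ℝ} (hF : ∀ᵐ z, ‖gaussWeighted F z‖ ≤ C) (a : Fin d → ℂ) :
    ‖gaussWeighted (fun a => ∫ z, R z * weylShift a F z) a‖
      ≤ (∫ z, ‖R z‖ * Real.exp (Real.pi * sqNorm z / 2)) * C := by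
  refine (norm_gaussWeighted_integral_le R F a).trans ?_
  rw [← integral_mul_const]
  refine integral_mono_of_nonneg (Filter.Eventually.of_forall fun z => by positivity)
    ((integrable_norm_mul_exp_sqNorm hR hc _).mul_const _) ?_
  filter_upwards [ae_comp_add_right hF a] with z hz
  exact mul_le_mul_of_nonneg_left hz (by positivity)

/-- The compact support of `R` turns the uniform Gaussian bound into an integrable majorant.
Convergence almost everywhere yields convergence of the integrals at every `a`. -/
theorem tendsto_integral_weylShift {R : (Fin d → ℂ) → ℂ} (hR : Continuous R)
    (hc : HasCompactSupport R) {F : ℕ → (Fin d → ℂ) → ℂ} {f : (Fin d → ℂ) → ℂ} {C : ℝ}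
    (hF : ∀ n, Continuous (F n)) (hb : ∀ n, ∀ᵐ z, ‖gaussWeighted (F n) z‖ ≤ C)
    (hlim : ∀ᵐ z, Filter.Tendsto (fun n => F n z) Filter.atTop (nhds (f z))) (a : Fin d → ℂ) :
    Filter.Tendsto (fun n => ∫ z, R z * weylShift a (F n) z) Filter.atTop
      (nhds (∫ z, R z * weylShift a f z)) := by
  have hexp : Continuous fun z : Fin d → ℂ =>
      Complex.exp (∑ i, (-(Real.pi : ℂ) * star (a i)) * z i) := by fun_prop
  refine tendsto_integral_of_dominated_convergence
    (fun z => ‖R z‖ * Real.exp (Real.pi * sqNorm z / 2) * (Real.exp (Real.pi * sqNorm a / 2) * C))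
    (fun n => (hR.mul (hexp.mul ((hF n).comp (continuous_id.add
      continuous_const)))).aestronglyMeasurable)
    ((integrable_norm_mul_exp_sqNorm hR hc _).mul_const _) (fun n => ?_) ?_
  · filter_upwards [ae_comp_add_right (hb n) a] with z hz
    rw [norm_mul, norm_weylShift]
    calc _ = ‖R z‖ * Real.exp (Real.pi * sqNorm z / 2) * (Real.exp (Real.pi * sqNorm a / 2) *
          ‖gaussWeighted (F n) (z + a)‖) := by ring
      _ ≤ _ := by gcongr
  · filter_upwards [ae_comp_add_right hlim a] with z hz
    exact (hz.const_mul _).const_mul _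

/-- Functions of the form `polyRaise k G`, `G` entire, are closed under almost everywhere
convergence with a uniform Gaussian bound. -/
theorem exists_polyRaise_eq_of_tendsto (k : Fin d → ℕ) {G : ℕ → (Fin d → ℂ) → ℂ}
    {f : (Fin d → ℂ) → ℂ} {C : ℝ} (hG : ∀ n, Differentiable ℂ (G n))
    (hb : ∀ n, ∀ᵐ z, ‖gaussWeighted (polyRaise k (G n)) z‖ ≤ C)
    (hlim : ∀ᵐ z, Filter.Tendsto (fun n => polyRaise k (G n) z) Filter.atTop (nhds (f z))) :
    ∃ g : (Fin d → ℂ) → ℂ, Differentiable ℂ g ∧ f =ᵐ[volume] polyRaise k g := by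
  obtain ⟨P, hP, hPc, hPr⟩ := exists_integral_polyRaise_eq k
  obtain ⟨Q, hQ, hQc, hQr⟩ := exists_polyRaise_eq_integral k
  have hcont : ∀ n, Continuous (polyRaise k (G n)) := fun n =>
    (isSmooth_polyRaise k (hG n).isSmooth).continuous
  -- The recovery formula is applied to the limit `f`, not yet known to lie in the range of
  -- `polyRaise k`; the `G n` then converge everywhere to `g`.
  let g : (Fin d → ℂ) → ℂ := fun a => ∫ z, P z * weylShift a f z
  have hg : ∀ a, Filter.Tendsto (fun n => G n a) Filter.atTop (nhds (g a)) := fun a => by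
    simp only [fun n => hPr (G n) (hG n) a]
    exact tendsto_integral_weylShift hP hPc hcont hb hlim a
  have hGb : ∀ n a, ‖gaussWeighted (G n) a‖
      ≤ (∫ z, ‖P z‖ * Real.exp (Real.pi * sqNorm z / 2)) * C := fun n a => by
    have := norm_gaussWeighted_integral_le_of_bound hP hPc (hb n) a
    rwa [← funext (hPr (G n) (hG n))] at this
  have hgd : Differentiable ℂ g := by
    refine differentiable_of_tendsto (M := fun z => Real.exp (Real.pi * sqNorm z / 2) *
        ((∫ z, ‖P z‖ * Real.exp (Real.pi * sqNorm z / 2)) * C)) hG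
      ((continuous_exp_sqNorm Real.pi).mul continuous_const) (fun n z => ?_) hg
    rw [norm_eq_exp_mul_norm_gaussWeighted]
    exact mul_le_mul_of_nonneg_left (hGb n z) (Real.exp_nonneg _)
  refine ⟨g, hgd, ?_⟩
  filter_upwards [hlim] with a ha
  refine tendsto_nhds_unique ha ?_
  simp only [fun n => hQr (G n) (hG n) a, hQr g hgd a]
  exact tendsto_integral_weylShift hQ hQc (fun n => (hG n).continuous)
    (fun n => Filter.Eventually.of_forall (hGb n)) (Filter.Eventually.of_forall hg) a

theorem integral_mul_norm_le_eLpNorm_mul_eLpNorm {α : Type*} [MeasurableSpace α] {μ : Measure α}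
    {ρ : α → ℝ} {g : α → ℂ} {p q : ℝ≥0∞} [ENNReal.HolderTriple q p 1] (hρ : MemLp ρ q μ)
    (hρ0 : ∀ x, 0 ≤ ρ x) (hg : MemLp g p μ) :
    ∫ x, ρ x * ‖g x‖ ∂μ ≤ (eLpNorm ρ q μ * eLpNorm g p μ).toReal := by
  have h1 : ∫ x, ρ x * ‖g x‖ ∂μ = (eLpNorm (ρ • g) 1 μ).toReal := by
    rw [eLpNorm_one_eq_lintegral_enorm, ← integral_norm_eq_lintegral_enorm (hρ.1.smul hg.1)]
    refine integral_congr_ae (Filter.Eventually.of_forall fun x => ?_)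
    simp [abs_of_nonneg (hρ0 x)]
  rw [h1]
  exact ENNReal.toReal_mono (ENNReal.mul_ne_top hρ.2.ne hg.2.ne)
    (eLpNorm_smul_le_mul_eLpNorm hg.1 hρ.1)

/-- Twisted convolution with a test function maps weighted `L^p` to weighted bounded functions. -/
theorem exists_bound_of_memLp {R F : (Fin d → ℂ) → ℂ} (hR : Continuous R)
    (hc : HasCompactSupport R) {p : ℝ≥0∞} (hp : 1 ≤ p) (hF : MemLp (gaussWeighted F) p volume) :
    ∃ C : ℝ, ∀ a, ‖gaussWeighted (fun a => ∫ z, R z * weylShift a F z) a‖ ≤ C := by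
  obtain ⟨q, hq⟩ : ∃ q, ENNReal.HolderConjugate q p :=
    ⟨_, (ENNReal.HolderConjugate.conjExponent hp).symm⟩
  let ρ : (Fin d → ℂ) → ℝ := fun z => ‖R z‖ * Real.exp (Real.pi * sqNorm z / 2)
  have hρm : MemLp ρ q volume :=
    (hR.norm.mul (continuous_exp_sqNorm _)).memLp_of_hasCompactSupport hc.norm.mul_right
  refine ⟨(eLpNorm ρ q volume * eLpNorm (gaussWeighted F) p volume).toReal,
    fun a => (norm_gaussWeighted_integral_le R F a).trans ?_⟩
  have hmp := measurePreserving_add_right (volume : Measure (Fin d → ℂ)) a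
  have h1 := integral_mul_norm_le_eLpNorm_mul_eLpNorm hρm
    (fun z => mul_nonneg (norm_nonneg _) (Real.exp_nonneg _)) (hF.comp_measurePreserving hmp)
  rwa [eLpNorm_comp_measurePreserving hF.1 hmp] at h1

theorem integrable_exp_neg_sqNorm {c : ℝ} (hc : 0 < c) :
    Integrable (fun z : Fin d → ℂ => Real.exp (-(c * sqNorm z))) volume := by
  have h1 : Integrable (fun x : ℂ => Real.exp (-(c * ‖x‖ ^ 2))) volume := by
    have := (GaussianFourier.integrable_cexp_neg_mul_sq_norm_add (V := ℂ) (b := (c : ℂ))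
      (by simpa using hc) 0 0).norm
    refine this.congr (Filter.Eventually.of_forall fun x => ?_)
    simp only [zero_mul, add_zero, Complex.norm_exp]
    congr 1
    rw [← Complex.ofReal_pow, ← Complex.ofReal_neg, ← Complex.ofReal_mul, Complex.ofReal_re]
    ring
  have h2 := Integrable.fintype_prod (ι := Fin d) (f := fun _ (x : ℂ) =>
    Real.exp (-(c * ‖x‖ ^ 2))) (μ := fun _ => volume) fun _ => h1
  refine h2.congr (Filter.Eventually.of_forall fun z => ?_)
  simp only [sqNorm, ← Real.exp_sum, Finset.sum_neg_distrib, Finset.mul_sum]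

/-- Moves Gaussian decay from `z + a` to `a`, at the cost of half the rate and a growing factor in
`z`. -/
theorem sqNorm_le_two_mul_add (z a : Fin d → ℂ) :
    sqNorm a ≤ 2 * sqNorm (z + a) + 2 * sqNorm z := by
  simp only [sqNorm, Finset.mul_sum, ← Finset.sum_add_distrib]
  refine Finset.sum_le_sum fun i _ => ?_
  have h : ‖a i‖ ≤ ‖z i + a i‖ + ‖z i‖ := by
    simpa using norm_sub_le (z i + a i) (z i)
  simp only [Pi.add_apply]
  nlinarith [norm_nonneg (a i), sq_nonneg (‖z i + a i‖ - ‖z i‖)]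

/-- If `G` has the Gaussian bound of Fock type with a strictly smaller exponent, then
`polyRaise k G` lies in the space of index one. -/
theorem polyRaise_mem_polyFock_one (k : Fin d → ℕ) {G : (Fin d → ℂ) → ℂ}
    (hG : Differentiable ℂ G) {C c : ℝ} (hc : 0 < c)
    (hb : ∀ z, ‖gaussWeighted G z‖ ≤ C * Real.exp (-(c * sqNorm z))) :
    polyRaise k G ∈ polyFock d k 1 := by
  obtain ⟨Q, hQ, hQc, hQr⟩ := exists_polyRaise_eq_integral k
  have hC : 0 ≤ C := by
    have := (norm_nonneg _).trans (hb 0)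
    exact nonneg_of_mul_nonneg_left this (Real.exp_pos _)
  refine ⟨⟨G, hG, rfl⟩, memLp_one_iff_integrable.2 ?_⟩
  have hint := (integrable_exp_neg_sqNorm (d := d) (half_pos hc)).const_mul
    ((∫ z, ‖Q z‖ * Real.exp ((Real.pi + 2 * c) * sqNorm z / 2)) * C)
  refine hint.mono' (continuous_gaussWeighted
    (isSmooth_polyRaise k hG.isSmooth).continuous).aestronglyMeasurable
    (Filter.Eventually.of_forall fun a => ?_)
  rw [funext (hQr G hG)]
  refine (norm_gaussWeighted_integral_le Q G a).trans ?_
  rw [mul_assoc, ← integral_mul_const]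
  refine integral_mono_of_nonneg (Filter.Eventually.of_forall fun z => by positivity)
    ((integrable_norm_mul_exp_sqNorm hQ hQc _).mul_const _)
    (Filter.Eventually.of_forall fun z => ?_)
  simp only
  -- Uses `e^{-c|z+a|²} ≤ e^{c|z|²} e^{-c|a|²/2}`; the growth in `z` is absorbed by the compact
  -- support of `Q`, whence the exponent `π + 2c`.
  calc _ ≤ ‖Q z‖ * Real.exp (Real.pi * sqNorm z / 2) *
        (C * (Real.exp (c * sqNorm z) * Real.exp (-(c / 2 * sqNorm a)))) := by
        gcongr
        refine (hb _).trans ?_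
        gcongr
        rw [← Real.exp_add]
        gcongr
        nlinarith [sqNorm_le_two_mul_add z a]
    _ = _ := by
        rw [show (Real.pi + 2 * c) * sqNorm z / 2 = Real.pi * sqNorm z / 2 + c * sqNorm z by ring,
          Real.exp_add]
        ring

/-- Functions in `polyFock d k p` are bounded limits of functions in `polyFock d k 1`. -/
theorem exists_approximation (k : Fin d → ℕ) {p : ℝ≥0∞} (hp : 1 ≤ p) {F : (Fin d → ℂ) → ℂ}
    (hF : F ∈ polyFock d k p) :
    ∃ (f : ℕ → (Fin d → ℂ) → ℂ) (C : ℝ), (∀ n, f n ∈ polyFock d k 1) ∧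
      (∀ n z, ‖gaussWeighted (f n) z‖ ≤ C) ∧
      ∀ z, Filter.Tendsto (fun n => f n z) Filter.atTop (nhds (F z)) := by
  obtain ⟨⟨G, hG, rfl⟩, hFp⟩ := hF
  obtain ⟨P, hP, hPc, hPr⟩ := exists_integral_polyRaise_eq k
  obtain ⟨Q, hQ, hQc, hQr⟩ := exists_polyRaise_eq_integral k
  obtain ⟨C, hC⟩ := exists_bound_of_memLp hP hPc hp hFp
  rw [← funext (hPr G hG)] at hC
  have hC0 : 0 ≤ C := (norm_nonneg _).trans (hC 0)
  let r : ℕ → ℝ := fun n => (n : ℝ) / (n + 1)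
  have hr0 : ∀ n, 0 ≤ r n := fun n => by positivity
  have hr1 : ∀ n, r n < 1 := fun n => (div_lt_one (by positivity)).2 (by linarith)
  have hrlim : Filter.Tendsto r Filter.atTop (nhds 1) := tendsto_natCast_div_add_atTop (1 : ℝ)
  -- Dilating `G` rather than `F` keeps the form `polyRaise k`. As `r n < 1`, the weighted dilate
  -- gains the decay `e^{-π(1 - r²)|z|²/2}`, which gives index one.
  let g : ℕ → (Fin d → ℂ) → ℂ := fun n z => G ((r n : ℂ) • z)
  have hg : ∀ n, Differentiable ℂ (g n) := fun n =>
    hG.comp (by fun_prop : Differentiable ℂ fun z : Fin d → ℂ => (r n : ℂ) • z)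
  have hgb : ∀ n z, ‖gaussWeighted (g n) z‖
      ≤ C * Real.exp (-(Real.pi * (1 - r n ^ 2) / 2 * sqNorm z)) := by
    intro n z
    have h1 := hC ((r n : ℂ) • z)
    have h2 : sqNorm ((r n : ℂ) • z) = r n ^ 2 * sqNorm z := by
      rw [sqNorm_smul, Complex.norm_real, Real.norm_of_nonneg (hr0 n)]
    rw [norm_gaussWeighted] at h1 ⊢
    have h3 : Real.exp (-(Real.pi * sqNorm z / 2))
        = Real.exp (-(Real.pi * sqNorm ((r n : ℂ) • z) / 2)) *
          Real.exp (-(Real.pi * (1 - r n ^ 2) / 2 * sqNorm z)) := by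
      rw [h2, ← Real.exp_add]
      congr 1
      ring
    rw [h3, ← mul_assoc]
    exact mul_le_mul_of_nonneg_right h1 (Real.exp_nonneg _)
  have hpos : ∀ n, 0 < Real.pi * (1 - r n ^ 2) / 2 := fun n => by
    have : r n ^ 2 < 1 := by nlinarith [hr0 n, hr1 n]
    have := Real.pi_pos
    apply div_pos (mul_pos this (by linarith)) two_pos
  have hgb' : ∀ n z, ‖gaussWeighted (g n) z‖ ≤ C := fun n z =>
    (hgb n z).trans (mul_le_of_le_one_right hC0 (Real.exp_le_one_iff.2
      (neg_nonpos.2 (mul_nonneg (hpos n).le (sqNorm_nonneg z)))))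
  refine ⟨fun n => polyRaise k (g n), (∫ z, ‖Q z‖ * Real.exp (Real.pi * sqNorm z / 2)) * C,
    fun n => polyRaise_mem_polyFock_one k (hg n) (hpos n)
    (hgb n), fun n z => ?_, fun z => ?_⟩
  · simp only [funext (hQr _ (hg n))]
    exact norm_gaussWeighted_integral_le_of_bound hQ hQc
      (Filter.Eventually.of_forall (hgb' n)) z
  · simp only [fun n => hQr _ (hg n) z, hQr G hG z]
    refine tendsto_integral_weylShift hQ hQc (fun n => (hg n).continuous)
      (fun n => Filter.Eventually.of_forall (hgb' n)) (Filter.Eventually.of_forall fun w => ?_) z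
    have h1 : Filter.Tendsto (fun n => (r n : ℂ) • w) Filter.atTop (nhds w) := by
      have := ((Complex.continuous_ofReal.tendsto 1).comp hrlim).smul_const w
      simpa using this
    exact (hG.continuous.tendsto w).comp h1

end Closure

/-! ### Young's inequality and domination of the kernel by a convolution. -/

section Kernel

variable {d : ℕ}

/-- Young's inequality for the convolution with a finite absolutely continuous measure. -/
theorem eLpNorm_lintegral_sub_le {f : (Fin d → ℂ) → ℂ} (hf : Continuous f)
    (ν : Measure (Fin d → ℂ)) [IsFiniteMeasure ν] (hν : ν ≪ volume) {p : ℝ≥0∞} (hp : 1 ≤ p) :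
    eLpNorm (fun z => ∫⁻ w, ‖f (z - w)‖ₑ ∂ν) p volume ≤ ν Set.univ * eLpNorm f p volume := by
  rcases eq_or_ne p ∞ with rfl | hpt
  · simp only [eLpNorm_exponent_top]
    refine eLpNormEssSup_le_of_ae_enorm_bound (Filter.Eventually.of_forall fun z => ?_)
    rw [enorm_eq_self, mul_comm, ← lintegral_const]
    -- The essential bound holds off a Lebesgue null set, which absolute continuity makes `ν`-null.
    refine lintegral_mono_ae (hν.ae_le ?_)
    exact (Measure.measurePreserving_sub_left volume z).quasiMeasurePreserving.ae
      (enorm_ae_le_eLpNormEssSup f volume)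
  · have hp0 : p ≠ 0 := (zero_lt_one.trans_le hp).ne'
    set r := p.toReal with hr
    have hr1 : 1 ≤ r := by
      rw [hr, ← ENNReal.toReal_one]
      exact ENNReal.toReal_mono hpt hp
    have hr0 : 0 < r := zero_lt_one.trans_le hr1
    have hfm : Measurable fun q : (Fin d → ℂ) × (Fin d → ℂ) => ‖f (q.1 - q.2)‖ₑ ^ r :=
      ((hf.comp (continuous_fst.sub continuous_snd)).enorm.measurable).pow_const r
    have jensen : ∀ z, (∫⁻ w, ‖f (z - w)‖ₑ ∂ν) ^ r
        ≤ ν Set.univ ^ (r - 1) * ∫⁻ w, ‖f (z - w)‖ₑ ^ r ∂ν := by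
      intro z
      have h := eLpNorm'_le_eLpNorm'_mul_rpow_measure_univ (μ := ν) zero_lt_one hr1
        (f := fun w => f (z - w)) (Continuous.aestronglyMeasurable (by fun_prop))
      simp only [eLpNorm', ENNReal.rpow_one, div_one] at h
      calc _ ≤ ((∫⁻ w, ‖f (z - w)‖ₑ ^ r ∂ν) ^ (1 / r) * ν Set.univ ^ (1 - 1 / r)) ^ r := by
            gcongr
        _ = _ := by
            rw [ENNReal.mul_rpow_of_nonneg _ _ hr0.le, ← ENNReal.rpow_mul, ← ENNReal.rpow_mul,
              one_div_mul_cancel hr0.ne', ENNReal.rpow_one, mul_comm, sub_mul,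
              one_div_mul_cancel hr0.ne', one_mul]
    have fubini : ∫⁻ z, ∫⁻ w, ‖f (z - w)‖ₑ ^ r ∂ν = (∫⁻ z, ‖f z‖ₑ ^ r) * ν Set.univ := by
      rw [lintegral_lintegral_swap hfm.aemeasurable, ← lintegral_const]
      refine lintegral_congr fun w => ?_
      exact lintegral_sub_right_eq_self (fun z => ‖f z‖ₑ ^ r) w
    rw [eLpNorm_eq_lintegral_rpow_enorm_toReal hp0 hpt,
      eLpNorm_eq_lintegral_rpow_enorm_toReal hp0 hpt, ← hr]
    simp only [enorm_eq_self]
    have hle : ∫⁻ z, (∫⁻ w, ‖f (z - w)‖ₑ ∂ν) ^ r ≤ ν Set.univ ^ r * ∫⁻ z, ‖f z‖ₑ ^ r := by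
      refine (lintegral_mono jensen).trans_eq ?_
      rw [lintegral_const_mul' _ _ (ENNReal.rpow_ne_top_of_nonneg (by linarith)
        (measure_ne_top ν _)), fubini, mul_left_comm, mul_comm]
      congr 1
      nth_rw 2 [← ENNReal.rpow_one (ν Set.univ)]
      rw [← ENNReal.rpow_add_of_nonneg _ _ (by linarith) zero_le_one, sub_add_cancel]
    calc _ ≤ (ν Set.univ ^ r * ∫⁻ z, ‖f z‖ₑ ^ r) ^ (1 / r) := by gcongr
      _ = _ := by
          rw [ENNReal.mul_rpow_of_nonneg _ _ (by positivity), ← ENNReal.rpow_mul,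
            mul_one_div_cancel hr0.ne', ENNReal.rpow_one]

/-- The real-linear involution `(x + iy, u + iv) ↦ (x - iv, u - iy)` of `ℂ^d × ℂ^d`. -/
def exchangeIm : (Fin d → ℂ) × (Fin d → ℂ) →ₗ[ℝ] (Fin d → ℂ) × (Fin d → ℂ) where
  toFun q := (fun j => ⟨(q.1 j).re, -(q.2 j).im⟩, fun j => ⟨(q.2 j).re, -(q.1 j).im⟩)
  map_add' q q' := by
    ext j <;> apply Complex.ext <;> simp <;> ring
  map_smul' c q := by
    ext j <;> apply Complex.ext <;> simp

/-- An involution has determinant of square one, hence of absolute value one. -/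
theorem measurePreserving_exchangeIm :
    MeasurePreserving (exchangeIm : (Fin d → ℂ) × (Fin d → ℂ) →ₗ[ℝ] _) := by
  have hinv : (exchangeIm : (Fin d → ℂ) × (Fin d → ℂ) →ₗ[ℝ] _) * exchangeIm = 1 := by
    refine LinearMap.ext fun q => ?_
    refine Prod.ext (funext fun j => ?_) (funext fun j => ?_) <;> apply Complex.ext <;>
      simp [exchangeIm]
  have hdet : LinearMap.det (exchangeIm : (Fin d → ℂ) × (Fin d → ℂ) →ₗ[ℝ] _) *
      LinearMap.det (exchangeIm : (Fin d → ℂ) × (Fin d → ℂ) →ₗ[ℝ] _) = 1 := by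
    rw [← map_mul, hinv, map_one]
  have : (volume : Measure ((Fin d → ℂ) × (Fin d → ℂ))).IsAddHaarMeasure :=
    Measure.prod.instIsAddHaarMeasure _ _
  have habs := abs_eq_abs.2 (mul_self_eq_one_iff.1 hdet)
  refine ⟨(LinearMap.continuous_of_finiteDimensional _).measurable, ?_⟩
  rw [Measure.map_linearMap_addHaar_eq_smul_addHaar _ (left_ne_zero_of_mul_eq_one hdet), abs_inv,
    habs]
  simp

/-- The growth condition on `ψ`, rewritten in the variables of the kernel. -/
theorem ae_norm_symbol_le {ψ : (Fin d → ℂ) → (Fin d → ℂ) → ℂ} {H : (Fin d → ℂ) → ℝ}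
    (hbound : ∀ᵐ q : (Fin d → ℂ) × (Fin d → ℂ) ∂volume,
      ‖ψ (q.1 - q.2) (star q.1 - q.2)‖ ≤
        ‖Complex.exp (Real.pi * ((sqNorm q.1 + sqNorm q.2 : ℝ) : ℂ) / 2
            - Real.pi * dotProduct q.2 (star q.1))‖ * H (q.1 - q.2)) :
    ∀ᵐ z : Fin d → ℂ, ∀ᵐ w : Fin d → ℂ, ‖ψ (z - w) (z - star w)‖ ≤
      Real.exp (Real.pi * (sqNorm z + sqNorm w) / 2 - Real.pi * (dotProduct z (star w)).re) *
        H (z - w) := by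
  have h := measurePreserving_exchangeIm.quasiMeasurePreserving.ae hbound
  rw [Measure.volume_eq_prod] at h
  filter_upwards [Measure.ae_ae_of_ae_prod h] with z hz
  filter_upwards [hz] with w hw
  -- The exchange fixes `z - w`, the sum of squared norms and the real part of the pairing, and
  -- sends `star z - w` to `z - star w`.
  have e1 : (exchangeIm (z, w)).1 - (exchangeIm (z, w)).2 = z - w := by
    funext j
    apply Complex.ext <;> simp [exchangeIm]; ring
  have e2 : star (exchangeIm (z, w)).1 - (exchangeIm (z, w)).2 = z - star w := by
    funext j
    apply Complex.ext <;> simp [exchangeIm]; ring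
  have e3 : sqNorm (exchangeIm (z, w)).1 + sqNorm (exchangeIm (z, w)).2
      = sqNorm z + sqNorm w := by
    simp only [sqNorm, ← Finset.sum_add_distrib]
    refine Finset.sum_congr rfl fun j _ => ?_
    simp only [exchangeIm, LinearMap.coe_mk, AddHom.coe_mk, ← Complex.normSq_eq_norm_sq,
      Complex.normSq_apply]
    ring
  have e4 : (dotProduct (exchangeIm (z, w)).2 (star (exchangeIm (z, w)).1)).re
      = (dotProduct z (star w)).re := by
    simp only [dotProduct, Complex.re_sum]
    refine Finset.sum_congr rfl fun j _ => ?_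
    simp [exchangeIm, Complex.mul_re]
    ring
  rw [e1, e2, e3, Complex.norm_exp] at hw
  convert hw using 3
  rw [Complex.sub_re, Complex.re_ofReal_mul, e4, ← Complex.ofReal_mul, ← Complex.ofReal_ofNat,
    ← Complex.ofReal_div, Complex.ofReal_re]

/-- Both choices of `κ` have the same real part, which the bound on `ψ` cancels; the remaining
exponents are the weights of `F` at `w` and of `SF` at `z`. -/
theorem norm_kernelIntegrand_le {κ ψ : (Fin d → ℂ) → (Fin d → ℂ) → ℂ} {H : (Fin d → ℂ) → ℝ}
    (hκ : κ = (fun z w => dotProduct z (star w)) ∨ κ = (fun z w => dotProduct (star z) w))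
    {z w : Fin d → ℂ} (hψ : ‖ψ (z - w) (z - star w)‖ ≤
      Real.exp (Real.pi * (sqNorm z + sqNorm w) / 2 - Real.pi * (dotProduct z (star w)).re) *
        H (z - w)) (F : (Fin d → ℂ) → ℂ) :
    ‖kernelIntegrand κ ψ F z w‖
      ≤ Real.exp (Real.pi * sqNorm z / 2) * (‖gaussWeighted F w‖ * ‖H (z - w)‖) := by
  have hre : (κ z w).re = (dotProduct z (star w)).re := by
    rcases hκ with rfl | rfl
    · rfl
    · simp only [dotProduct, Complex.re_sum]
      refine Finset.sum_congr rfl fun j _ => ?_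
      simp [Complex.mul_re]
  rw [kernelIntegrand, norm_mul, norm_mul, norm_mul, Complex.norm_exp, Complex.re_ofReal_mul, hre,
    Complex.norm_real, Real.norm_of_nonneg (Real.exp_nonneg _), norm_gaussWeighted]
  calc _ ≤ ‖F w‖ * Real.exp (Real.pi * (dotProduct z (star w)).re) *
        (Real.exp (Real.pi * (sqNorm z + sqNorm w) / 2 - Real.pi * (dotProduct z (star w)).re) *
        ‖H (z - w)‖) * Real.exp (-(Real.pi * sqNorm w)) := by
        gcongr
        exact hψ.trans (by gcongr; exact le_abs_self _)
    _ = ‖F w‖ * ‖H (z - w)‖ * (Real.exp (Real.pi * (dotProduct z (star w)).re) *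
        Real.exp (Real.pi * (sqNorm z + sqNorm w) / 2 - Real.pi * (dotProduct z (star w)).re) *
        Real.exp (-(Real.pi * sqNorm w))) := by ring
    _ = ‖F w‖ * ‖H (z - w)‖ * (Real.exp (Real.pi * sqNorm z / 2) *
        Real.exp (-(Real.pi * sqNorm w / 2))) := by
        rw [← Real.exp_add, ← Real.exp_add, ← Real.exp_add]
        congr 2
        ring
    _ = _ := by ring

theorem ae_aestronglyMeasurable_kernelIntegrand {κ ψ : (Fin d → ℂ) → (Fin d → ℂ) → ℂ}
    (hκ : κ = (fun z w => dotProduct z (star w)) ∨ κ = (fun z w => dotProduct (star z) w))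
    (hψ : AEStronglyMeasurable
      (fun q : (Fin d → ℂ) × (Fin d → ℂ) => ψ (q.1 - q.2) (q.1 - star q.2)) volume) :
    ∀ᵐ z : Fin d → ℂ, ∀ F : (Fin d → ℂ) → ℂ, Continuous F →
      AEStronglyMeasurable (kernelIntegrand κ ψ F z) volume := by
  rw [Measure.volume_eq_prod] at hψ
  filter_upwards [hψ.prodMk_left] with z hz F hF
  have hκc : Continuous (κ z) := by
    rcases hκ with rfl | rfl
    · exact continuous_finsetSum _ fun j _ =>
        continuous_const.mul (continuous_star.comp (continuous_apply j))
    · exact continuous_finsetSum _ fun j _ => continuous_const.mul (continuous_apply j)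
  have h1 : Continuous fun w => F w * Complex.exp (Real.pi * κ z w) :=
    hF.mul (Complex.continuous_exp.comp (continuous_const.mul hκc))
  exact (h1.aestronglyMeasurable.mul hz).mul isSmooth_gaussian.continuous.aestronglyMeasurable

theorem continuous_of_mem_polyFock {k : Fin d → ℕ} {p : ℝ≥0∞} {F : (Fin d → ℂ) → ℂ}
    (hF : F ∈ polyFock d k p) : Continuous F := by
  obtain ⟨⟨G, hG, rfl⟩, -⟩ := hF
  exact (isSmooth_polyRaise k hG.isSmooth).continuous

/-- After the Gaussian cancellation this is Young's inequality for the finite measure with density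
`|H|`. -/
theorem eLpNorm_gaussWeighted_kernelOp_le {κ ψ : (Fin d → ℂ) → (Fin d → ℂ) → ℂ}
    {H : (Fin d → ℂ) → ℝ}
    (hκ : κ = (fun z w => dotProduct z (star w)) ∨ κ = (fun z w => dotProduct (star z) w))
    (hH : Integrable H volume)
    (hψ : ∀ᵐ z : Fin d → ℂ, ∀ᵐ w : Fin d → ℂ, ‖ψ (z - w) (z - star w)‖ ≤
      Real.exp (Real.pi * (sqNorm z + sqNorm w) / 2 - Real.pi * (dotProduct z (star w)).re) *
        H (z - w)) {F : (Fin d → ℂ) → ℂ} (hF : Continuous F) {p : ℝ≥0∞} (hp : 1 ≤ p) :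
    eLpNorm (gaussWeighted (kernelOp κ ψ F)) p volume
      ≤ (∫⁻ w, ‖H w‖ₑ) * eLpNorm (gaussWeighted F) p volume := by
  let ν : Measure (Fin d → ℂ) := volume.withDensity fun w => ‖H w‖ₑ
  have : IsFiniteMeasure ν := isFiniteMeasure_withDensity hH.2.ne
  have hνu : ν Set.univ = ∫⁻ w, ‖H w‖ₑ := by simp [ν]
  rw [← hνu]
  refine le_trans (eLpNorm_mono_enorm_ae ?_) (eLpNorm_lintegral_sub_le
    (continuous_gaussWeighted hF) ν (withDensity_absolutelyContinuous _ _) hp)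
  filter_upwards [hψ] with z hz
  have hm : Continuous fun w => gaussWeighted F (z - w) :=
    (continuous_gaussWeighted hF).comp (continuous_const.sub continuous_id)
  have h1 : ∫⁻ w, ‖gaussWeighted F (z - w)‖ₑ ∂ν
      = ∫⁻ w, ‖gaussWeighted F w‖ₑ * ‖H (z - w)‖ₑ := by
    rw [lintegral_withDensity_eq_lintegral_mul₀ hH.1.enorm hm.enorm.measurable.aemeasurable,
      ← lintegral_sub_left_eq_self (fun w => ‖gaussWeighted F w‖ₑ * ‖H (z - w)‖ₑ) z]
    refine lintegral_congr fun w => ?_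
    simp only [Pi.mul_apply, sub_sub_cancel, mul_comm]
  have h2 : gaussWeighted (kernelOp κ ψ F) z = ∫ w, kernelIntegrand κ ψ F z w *
      (Real.exp (-(Real.pi * sqNorm z / 2)) : ℂ) := by
    rw [integral_mul_const]
    rfl
  rw [enorm_eq_self, h1, h2]
  refine (enorm_integral_le_lintegral_enorm _).trans (lintegral_mono_ae ?_)
  filter_upwards [hz] with w hw
  rw [← enorm_norm (gaussWeighted F w), ← enorm_mul]
  refine enorm_le_iff_norm_le.2 ?_
  rw [norm_mul, norm_mul, norm_norm, Complex.norm_real, Real.norm_of_nonneg (Real.exp_nonneg _)]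
  calc _ ≤ Real.exp (Real.pi * sqNorm z / 2) * (‖gaussWeighted F w‖ * ‖H (z - w)‖) *
        Real.exp (-(Real.pi * sqNorm z / 2)) :=
        mul_le_mul_of_nonneg_right (norm_kernelIntegrand_le hκ hw F) (Real.exp_nonneg _)
    _ = ‖gaussWeighted F w‖ * ‖H (z - w)‖ * (Real.exp (Real.pi * sqNorm z / 2) *
        Real.exp (-(Real.pi * sqNorm z / 2))) := by ring
    _ = _ := by rw [← Real.exp_add, add_neg_cancel, Real.exp_zero, mul_one]

end Kernel

/-! ### The boundedness theorem. -/

theorem mainTheorem4 (d : ℕ) (k : Fin d → ℕ)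
    (κ : (Fin d → ℂ) → (Fin d → ℂ) → ℂ)
    (hκ : κ = (fun z w => dotProduct z (star w)) ∨ κ = (fun z w => dotProduct (star z) w))
    (ψ : (Fin d → ℂ) → (Fin d → ℂ) → ℂ)
    (hψ : AEStronglyMeasurable
      (fun q : (Fin d → ℂ) × (Fin d → ℂ) => ψ (q.1 - q.2) (q.1 - star q.2)) volume)
    (hS : ∀ F ∈ polyFock d k 1, ∃ G ∈ polyFock d k ∞, kernelOp κ ψ F =ᵐ[volume] G)
    (H : (Fin d → ℂ) → ℝ) (hH : Integrable H volume)
    (hbound : ∀ᵐ q : (Fin d → ℂ) × (Fin d → ℂ) ∂volume,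
      ‖ψ (q.1 - q.2) (star q.1 - q.2)‖ ≤
        ‖Complex.exp (Real.pi * ((sqNorm q.1 + sqNorm q.2 : ℝ) : ℂ) / 2
            - Real.pi * dotProduct q.2 (star q.1))‖ * H (q.1 - q.2)) :
    ∀ p : ℝ≥0∞, 1 ≤ p → ∃ C : ℝ≥0, ∀ F ∈ polyFock d k p,
      (∀ᵐ z : Fin d → ℂ ∂volume, Integrable (kernelIntegrand κ ψ F z) volume) ∧
      ∃ G ∈ polyFock d k p, kernelOp κ ψ F =ᵐ[volume] G ∧ fockNorm p G ≤ C * fockNorm p F := by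
  intro p hp
  have hψb := ae_norm_symbol_le hbound
  have hψm := ae_aestronglyMeasurable_kernelIntegrand hκ hψ
  have hHi : ∀ z : Fin d → ℂ, Integrable (fun w => H (z - w)) volume := fun z =>
    hH.comp_sub_left z
  have hdom : ∀ {F : (Fin d → ℂ) → ℂ} {C : ℝ} {z w : Fin d → ℂ},
      ‖ψ (z - w) (z - star w)‖ ≤ Real.exp (Real.pi * (sqNorm z + sqNorm w) / 2 -
        Real.pi * (dotProduct z (star w)).re) * H (z - w) → ‖gaussWeighted F w‖ ≤ C →
      ‖kernelIntegrand κ ψ F z w‖ ≤ Real.exp (Real.pi * sqNorm z / 2) * (C * ‖H (z - w)‖) :=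
    fun h1 h2 => (norm_kernelIntegrand_le hκ h1 _).trans (by gcongr)
  have hdomi : ∀ (C : ℝ) (z : Fin d → ℂ), Integrable
      (fun w => Real.exp (Real.pi * sqNorm z / 2) * (C * ‖H (z - w)‖)) volume := fun C z =>
    ((hHi z).norm.const_mul C).const_mul _
  refine ⟨(∫⁻ w, ‖H w‖ₑ).toNNReal, fun F hF => ?_⟩
  have hFc := continuous_of_mem_polyFock hF
  obtain ⟨f, C, hf, hfb, hflim⟩ := exists_approximation k hp hF
  -- The uniform bound passes to `F`, so the integrand is dominated by a translate of `|H|`,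
  -- whatever `p` is.
  have hFb : ∀ z, ‖gaussWeighted F z‖ ≤ C := fun z =>
    le_of_tendsto ((hflim z).mul_const _).norm (Filter.Eventually.of_forall fun n => hfb n z)
  refine ⟨?_, ?_⟩
  · filter_upwards [hψb, hψm] with z hz hzm
    refine (hdomi C z).mono' (hzm F hFc) ?_
    filter_upwards [hz] with w hw using hdom hw (hFb w)
  choose g hg hgS using fun n => hS (f n) (hf n)
  -- The mapping hypothesis supplies the form `polyRaise k (γ n)` of the images; their uniform
  -- weighted bound comes from `H`.
  choose γ hγ hgγ using fun n => (hg n).1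
  have hlim : ∀ᵐ z, Filter.Tendsto (fun n => polyRaise k (γ n) z) Filter.atTop
      (nhds (kernelOp κ ψ F z)) := by
    filter_upwards [hψb, hψm, ae_all_iff.2 hgS] with z hz hzm hzg
    simp only [← hgγ, ← hzg]
    refine tendsto_integral_of_dominated_convergence _
      (fun n => hzm (f n) (continuous_of_mem_polyFock (hf n))) (hdomi C z) (fun n => ?_)
      (Filter.Eventually.of_forall fun w => ?_)
    · filter_upwards [hz] with w hw using hdom hw (hfb n w)
    · exact (((hflim w).mul_const _).mul_const _).mul_const _
  have hb : ∀ n, ∀ᵐ z, ‖gaussWeighted (polyRaise k (γ n)) z‖ ≤ C * ∫ w, ‖H w‖ := by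
    intro n
    filter_upwards [hψb, hgS n] with z hz hzg
    rw [norm_gaussWeighted, ← hgγ, ← hzg]
    have h1 : ‖kernelOp κ ψ (f n) z‖ ≤ Real.exp (Real.pi * sqNorm z / 2) *
        (C * ∫ w, ‖H w‖) := by
      refine (norm_integral_le_of_norm_le (hdomi C z) ?_).trans_eq ?_
      · filter_upwards [hz] with w hw using hdom hw (hfb n w)
      · rw [integral_const_mul, integral_const_mul,
          integral_sub_left_eq_self (fun w => ‖H w‖) volume z]
    calc _ ≤ Real.exp (Real.pi * sqNorm z / 2) * (C * ∫ w, ‖H w‖) *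
          Real.exp (-(Real.pi * sqNorm z / 2)) := by gcongr
      _ = (C * ∫ w, ‖H w‖) * (Real.exp (Real.pi * sqNorm z / 2) *
          Real.exp (-(Real.pi * sqNorm z / 2))) := by ring
      _ = _ := by rw [← Real.exp_add, add_neg_cancel, Real.exp_zero, mul_one]
  obtain ⟨G, hG, hSG⟩ := exists_polyRaise_eq_of_tendsto k hγ hb hlim
  have hnorm : fockNorm p (polyRaise k G) ≤ (∫⁻ w, ‖H w‖ₑ).toNNReal * fockNorm p F := by
    rw [ENNReal.coe_toNNReal hH.2.ne]
    refine le_trans (eLpNorm_congr_ae ?_).le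
      (eLpNorm_gaussWeighted_kernelOp_le hκ hH hψb hFc hp)
    filter_upwards [hSG] with z hz
    rw [gaussWeighted, gaussWeighted, hz]
  exact ⟨polyRaise k G, ⟨⟨G, hG, rfl⟩, (continuous_gaussWeighted
    (isSmooth_polyRaise k hG.isSmooth).continuous).aestronglyMeasurable,
    hnorm.trans_lt (ENNReal.mul_lt_top ENNReal.coe_lt_top hF.2.2)⟩, hSG, hnorm⟩
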